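/- Let $\mathbb{F}_q$ be a fixed finite field with $q$ elements and let $\emptyset\neq\mathcal{A}\subsetneq\mathbb{F}_q$ be fixed. For a matrix $\mathbf{N}$ over $\mathbb{F}_q$ let $\mathrm{ct}_{\mathcal{A}}(\mathbf{N})$ be the number of entries of $\mathbf{N}$ that lie in $\mathcal{A}$. Put $\gamma_{\mathcal{A}}=q^{-1}\#\mathcal{A}-\mathbf{1}_{\mathcal{A}}(0)$ and, for positive integers $m,n,r$, $$\mu_{\mathcal{A}}=mn\left(q^{-1}\#\mathcal{A}-q^{-r}\gamma_{\mathcal{A}}\right),$$ $$\sigma_{\mathcal{A}}^2=mn\left(q^{-1}\#\mathcal{A}-q^{-r}\gamma_{\mathcal{A}}\right)\left(1-q^{-1}\#\mathcal{A}+q^{-r}\gamma_{\mathcal{A}}\right)+mn(m+n-2)\,q^{-r}(1-q^{-r})\,\gamma_{\mathcal{A}}^2 .$$ Let $\mathbf{X}\in\mathbb{F}_q^{m\times r}$ and $\mathbf{Y}\in\mathbb{F}_q^{r\times n}$ be independent random matrices, each uniformly distributed in its space, and let $$\widetilde{\mathrm{ct}}_{\mathcal{A}}(\mathbf{XY})=\frac{\mathrm{ct}_{\mathcal{A}}(\mathbf{XY})-\mu_{\mathcal{A}}}{\sqrt{\sigma_{\mathcal{A}}^2}}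 .$$ (a) For all positive integers $m,n,r$ one has $\mathbb{E}[\mathrm{ct}_{\mathcal{A}}(\mathbf{XY})]=\mu_{\mathcal{A}}$ and $\mathrm{Var}[\mathrm{ct}_{\mathcal{A}}(\mathbf{XY})]=\sigma_{\mathcal{A}}^2>0$; hence $\mathbb{E}[\widetilde{\mathrm{ct}}_{\mathcal{A}}(\mathbf{XY})]=0$ and $\mathbb{E}[\widetilde{\mathrm{ct}}_{\mathcal{A}}(\mathbf{XY})^2]=1$. (b) Let $m,n\to\infty$, with $r\ge 1$ allowed to vary with $m,n$, in such a way that one of the following holds: (i) $q^r/\min\{m,n\}\to 0$; (ii) $q^r/(m+n)^a\to\infty$ for every fixed real $a>0$; (iii) $m\asymp n$ and $q^r/m\to\infty$. Then for every fixed integer $\ell\ge 3$, $$\mathbb{E}\left[\widetilde{\mathrm{ct}}_{\mathcal{A}}(\mathbf{XY})^{\ell}\right]=\begin{cases}o(1)&(\ell\text{ odd}),\\(\ell-1)!!+o(1)&(\ell\text{ even}).\end{cases}$$ -/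

import Mathlib

open MeasureTheory ProbabilityTheory Filter Asymptotics
open scoped Topology

noncomputable section

/-- Matrices over a finite field form a finite set, which carries the discrete σ-algebra. -/
instance matrixDiscreteMeasurableSpace {F : Type*} [Finite F] (a b : ℕ) :
    MeasurableSpace (Matrix (Fin a) (Fin b) F) := ⊤

instance matrixDiscreteMeasurableSpace_discrete {F : Type*} [Finite F] (a b : ℕ) :
    DiscreteMeasurableSpace (Matrix (Fin a) (Fin b) F) := ⟨fun _ => trivial⟩

variable {F : Type*} [Field F] [Fintype F] [DecidableEq F]

/-- The number of entries of `M` that belong to `A`. -/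
def ct (A : Finset F) {m n : ℕ} (M : Matrix (Fin m) (Fin n) F) : ℕ :=
  (Finset.univ.filter fun p : Fin m × Fin n => M p.1 p.2 ∈ A).card

/-- `γ_A(q) = q⁻¹ #A - 1_A(0)`, with `q` the order of `F`. -/
def gammaA (A : Finset F) : ℝ :=
  (Fintype.card F : ℝ)⁻¹ * (A.card : ℝ) - (if (0 : F) ∈ A then 1 else 0)

/-- `μ_A(q,m,n,r) = mn (q⁻¹ #A - q⁻ʳ γ_A(q))`. -/
def muA (A : Finset F) (m n r : ℕ) : ℝ :=
  (m : ℝ) * n * ((Fintype.card F : ℝ)⁻¹ * A.card - ((Fintype.card F : ℝ) ^ r)⁻¹ * gammaA A)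

/-- `σ_A²(q,m,n,r)`. -/
def sigmaSqA (A : Finset F) (m n r : ℕ) : ℝ :=
  (m : ℝ) * n * ((Fintype.card F : ℝ)⁻¹ * A.card - ((Fintype.card F : ℝ) ^ r)⁻¹ * gammaA A)
      * (1 - (Fintype.card F : ℝ)⁻¹ * A.card + ((Fintype.card F : ℝ) ^ r)⁻¹ * gammaA A)
    + (m : ℝ) * n * ((m : ℝ) + n - 2) * ((Fintype.card F : ℝ) ^ r)⁻¹
      * (1 - ((Fintype.card F : ℝ) ^ r)⁻¹) * gammaA A ^ 2

/-- The normalized count `(ct_A(N) - μ_A(q,m,n,r)) / √(σ_A²(q,m,n,r))`. -/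
def ctNormalized (A : Finset F) {m n : ℕ} (r : ℕ) (N : Matrix (Fin m) (Fin n) F) : ℝ :=
  ((ct A N : ℝ) - muA A m n r) / √(sigmaSqA A m n r)

/-- `X` is uniformly distributed in the space of all `a × b` matrices over `F`. -/
def IsUniformMatrix {Ω : Type*} [MeasurableSpace Ω] (P : Measure Ω) {a b : ℕ}
    (X : Ω → Matrix (Fin a) (Fin b) F) : Prop :=
  HasLaw X (uniformOn (Set.univ : Set (Matrix (Fin a) (Fin b) F))) P

/-- The three growth regimes for `m, n, r` (over a field with `q` elements) along the filter `l`. -/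
def GrowthCondition (q : ℕ) {ι : Type*} (l : Filter ι) (m n r : ι → ℕ) : Prop :=
  Tendsto (fun i => (q : ℝ) ^ r i / (min (m i) (n i) : ℕ)) l (𝓝 0) ∨
  (∀ a : ℝ, 0 < a →
    Tendsto (fun i => (q : ℝ) ^ r i / ((m i : ℝ) + n i) ^ a) l atTop) ∨
  ((fun i => (m i : ℝ)) =Θ[l] (fun i => (n i : ℝ)) ∧
    Tendsto (fun i => (q : ℝ) ^ r i / (m i : ℝ)) l atTop)

end

/-! Write `x i` for the rows of the left factor, `y j` for the columns of the right one: independent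
uniform vectors of length r. Put p = q⁻ʳ and let d be the density of A. For fixed x the product x ⬝
y is uniform if x ≠ 0 and vanishes if x = 0, so 1_A(x ⬝ y) has conditional mean d - γ 1_{x=0}. This
yields the Hoeffding decomposition `centredCount_eq`: the centred count is a linear part, a sum over
rows and columns of multiples of p - 1_{x=0}, plus a degenerate part, the sum of a kernel centred in
each argument separately. Mean and variance follow from the pair covariances, which vanish unless
two entries share a row or a column.

The linear part has variance γ² mn(m+n) p(1-p). The degenerate part has 2k-th moment O((mn)^k), and
for small p it has variance about mn d(1-d). In regime (i), mp and np tend to infinity: the linear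
part dominates, and it is a sum of independent, uniformly small variables, so the moment form of the
central limit theorem (`exists_abs_expect_sum_pow_sub_le`) applies.

In regimes (ii) and (iii) all normalized moments of the linear part tend to zero, and the degenerate
part is compared with a sum of mn independent centred Bernoulli variables
(`exists_abs_expect_sum_resKernel_pow_sub_le`). An l-th moment is a sum over l-tuples of positions.
Only tuples in which every row index and every column index that occurs is repeated contribute, and
there are O((mn)^⌊l/2⌋) of them. For each tuple the chosen entries of XY are independent and uniform
unless the columns involved are linearly dependent, an event of probability at most q^l p. The
normalized error is therefore O(p).

Perturbations with vanishing moments do not change Gaussian limits (`tendsto_expect_add_pow`), and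
the second moment identifies σ² with any other correct normalization. -/

open scoped BigOperators

/-! ### Averages over finite product spaces, and the passage from random matrices to them. -/

/-- Averaging over an additive group is invariant under adding an arbitrary random shift. -/
theorem expect_eq_expect_expect_add {G W : Type*} [AddGroup G] [Fintype G] [Fintype W] [Nonempty W]
    (T : W → G) (φ : G → ℝ) : 𝔼 x, φ x = 𝔼 x, 𝔼 w, φ (x + T w) := by
  rw [Finset.expect_comm]
  have h : ∀ w, 𝔼 x, φ (x + T w) = 𝔼 x, φ x := fun w =>
    Fintype.expect_equiv (Equiv.addRight (T w)) _ _ fun _ => rfl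
  simp [h]

/-- Averaging over a power of `V` is unchanged when one coordinate is resampled. -/
theorem expect_eq_expect_expect_update {I V : Type*} [Fintype I] [DecidableEq I] [Fintype V]
    [Nonempty V] (a : I) (φ : (I → V) → ℝ) :
    𝔼 ω, φ ω = 𝔼 ω, 𝔼 v, φ (Function.update ω a v) := by
  have h1 : 𝔼 ω, φ ω = 𝔼 z : (I → V) × V, φ z.1 := by
    rw [← Finset.univ_product_univ, Finset.expect_product]; simp
  have h2 : 𝔼 ω, 𝔼 v, φ (Function.update ω a v)
      = 𝔼 z : (I → V) × V, φ (Function.update z.1 a z.2) := by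
    rw [← Finset.univ_product_univ, Finset.expect_product]
  rw [h1, h2]
  -- Exchanging the coordinate at `a` with the fresh sample is an involution of the enlarged space,
  -- hence preserves averages.
  refine (Fintype.expect_bijective (fun z : (I → V) × V => (Function.update z.1 a z.2, z.1 a)) ?_ _ _
    fun _ => rfl).symm
  refine Function.Involutive.bijective fun z => ?_
  ext <;> simp

theorem expect_comp_eval {I V : Type*} [Fintype I] [DecidableEq I] [Fintype V] [Nonempty V]
    (a : I) (φ : V → ℝ) : 𝔼 ω : I → V, φ (ω a) = 𝔼 v, φ v := by
  rw [expect_eq_expect_expect_update a]; simp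

theorem expect_comp_eval_eval {I V : Type*} [Fintype I] [DecidableEq I] [Fintype V] [Nonempty V]
    {a b : I} (hab : a ≠ b) (φ : V → V → ℝ) :
    𝔼 ω : I → V, φ (ω a) (ω b) = 𝔼 v, 𝔼 w, φ v w := by
  rw [expect_eq_expect_expect_update b]
  simp only [Function.update_of_ne hab, Function.update_self]
  exact expect_comp_eval a fun v => 𝔼 w, φ v w

theorem integral_uniformOn_univ {α : Type*} [Fintype α] [Nonempty α] [MeasurableSpace α]
    [DiscreteMeasurableSpace α] (f : α → ℝ) :
    ∫ a, f a ∂(uniformOn (Set.univ : Set α)) = 𝔼 a, f a := by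
  have := isProbabilityMeasure_uniformOn (s := (Set.univ : Set α)) Set.finite_univ
    Set.univ_nonempty
  rw [integral_fintype Integrable.of_finite, Fintype.expect_eq_sum_div_card, Finset.sum_div]
  refine Finset.sum_congr rfl fun a _ => ?_
  simp [Measure.real, uniformOn_univ, div_eq_inv_mul]

theorem aemeasurable_comp_of_isUniformMatrix {F : Type*} [Field F] [Fintype F] [DecidableEq F]
    {Ω : Type*} [MeasurableSpace Ω] {P : Measure Ω} {m n r : ℕ}
    {X : Ω → Matrix (Fin m) (Fin r) F} {Y : Ω → Matrix (Fin r) (Fin n) F}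
    (hX : IsUniformMatrix P X) (hY : IsUniformMatrix P Y)
    (Φ : Matrix (Fin m) (Fin r) F → Matrix (Fin r) (Fin n) F → ℝ) :
    AEMeasurable (fun ω => Φ (X ω) (Y ω)) P := by
  have h : Measurable fun z : Matrix (Fin m) (Fin r) F × Matrix (Fin r) (Fin n) F => Φ z.1 z.2 :=
    Measurable.of_discrete
  exact h.comp_aemeasurable (HasLaw.aemeasurable hX |>.prodMk (HasLaw.aemeasurable hY))

/-- Indexing the right factor by its columns makes the entries of the product dot products of two
symmetric families of vectors. -/
theorem integral_comp_of_isUniformMatrix {F : Type*} [Field F] [Fintype F] [DecidableEq F]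
    {Ω : Type*} [MeasurableSpace Ω] (P : Measure Ω) [IsProbabilityMeasure P] {m n r : ℕ}
    (X : Ω → Matrix (Fin m) (Fin r) F) (Y : Ω → Matrix (Fin r) (Fin n) F)
    (hX : IsUniformMatrix P X) (hY : IsUniformMatrix P Y) (hXY : IndepFun X Y P)
    (Φ : Matrix (Fin m) (Fin r) F → Matrix (Fin r) (Fin n) F → ℝ) :
    ∫ ω, Φ (X ω) (Y ω) ∂P
      = 𝔼 x : Fin m → Fin r → F, 𝔼 y : Fin n → Fin r → F, Φ (Matrix.of x) (Matrix.of y).transpose := by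
  have p1 := isProbabilityMeasure_uniformOn (s := (Set.univ : Set (Matrix (Fin m) (Fin r) F)))
    Set.finite_univ Set.univ_nonempty
  have p2 := isProbabilityMeasure_uniformOn (s := (Set.univ : Set (Matrix (Fin r) (Fin n) F)))
    Set.finite_univ Set.univ_nonempty
  have h := (indepFun_iff_hasLaw_prodMk_prod hX hY).1 hXY
  have h2 := h.integral_comp (f := fun z => Φ z.1 z.2)
    (Measurable.of_discrete.aestronglyMeasurable)
  simp only [Function.comp_def] at h2
  rw [h2, integral_prod _ Integrable.of_finite]
  simp_rw [integral_uniformOn_univ]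
  refine Finset.expect_congr rfl fun x _ => ?_
  exact Fintype.expect_equiv ⟨fun y => fun b a => y a b, fun y => fun a b => y b a,
    fun _ => rfl, fun _ => rfl⟩ _ _ fun _ => rfl

/-! ### Gaussian moments and a quantitative central limit theorem for moments. -/

/-- The moments of the standard Gaussian distribution. -/
noncomputable def gaussMoment : ℕ → ℝ
  | 0 => 1
  | 1 => 0
  | n + 2 => (n + 1) * gaussMoment n

theorem gaussMoment_nonneg : ∀ n, 0 ≤ gaussMoment n
  | 0 => by simp [gaussMoment]
  | 1 => by simp [gaussMoment]
  | n + 2 => by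
    have := gaussMoment_nonneg n
    rw [gaussMoment]; positivity

theorem gaussMoment_odd {n : ℕ} (hn : Odd n) : gaussMoment n = 0 := by
  obtain ⟨k, rfl⟩ := hn
  induction k with
  | zero => simp [gaussMoment]
  | succ k ih =>
    rw [show 2 * (k + 1) + 1 = (2 * k + 1) + 2 by ring, gaussMoment, ih, mul_zero]

theorem gaussMoment_even {n : ℕ} (hn : Even n) :
    gaussMoment n = ((n - 1).doubleFactorial : ℝ) := by
  obtain ⟨k, rfl⟩ := hn
  rw [← two_mul]
  induction k with
  | zero => simp [gaussMoment]
  | succ k ih =>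
    rw [show 2 * (k + 1) = 2 * k + 2 by ring, gaussMoment, ih]
    rcases k with _ | k
    · simp
    · rw [show 2 * (k + 1) + 2 - 1 = (2 * k + 1) + 2 by omega,
        show 2 * (k + 1) - 1 = 2 * k + 1 by omega, Nat.doubleFactorial]
      push_cast; ring

/-- The heat equation for Gaussian moments, at the level of coefficients: it matches the derivative
of the (n+2)-nd moment in the variance with the n-th moment. For odd n both sides vanish, so the
truncated division is harmless. -/
theorem choose_mul_gaussMoment (n : ℕ) :
    ((n + 2).choose 2 : ℝ) * gaussMoment n = ((n + 2 : ℕ) / 2 : ℕ) * gaussMoment (n + 2) := by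
  rcases Nat.even_or_odd n with ⟨k, rfl⟩ | hn
  · have h : (k + k + 2) / 2 = k + 1 := by omega
    rw [h, gaussMoment, Nat.cast_choose_two]
    push_cast; ring
  · rw [gaussMoment_odd hn, gaussMoment_odd (by simpa [parity_simps] using hn)]; simp

theorem abs_add_pow_sub_le (k : ℕ) {t v : ℝ} (ht : 0 ≤ t) (hv : 0 ≤ v) (h : t + v ≤ 1) :
    |(t + v) ^ (k + 1) - t ^ (k + 1) - (k + 1) * v * t ^ k| ≤ (k + 1) ^ 2 * v ^ 2 := by
  induction k with
  | zero => simp; positivity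
  | succ k ih =>
    have e : (t + v) ^ (k + 1 + 1) - t ^ (k + 1 + 1) - ((k + 1 : ℕ) + 1) * v * t ^ (k + 1)
        = (t + v) * ((t + v) ^ (k + 1) - t ^ (k + 1) - (k + 1) * v * t ^ k)
          + (k + 1) * v ^ 2 * t ^ k := by push_cast; ring
    have h1 : t ^ k ≤ 1 := pow_le_one₀ ht (by linarith)
    rw [e]
    refine (abs_add_le _ _).trans ?_
    rw [abs_mul, abs_of_nonneg (by positivity : 0 ≤ t + v),
      abs_of_nonneg (by positivity : 0 ≤ ((k : ℝ) + 1) * v ^ 2 * t ^ k)]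
    have h2 : (t + v) * |(t + v) ^ (k + 1) - t ^ (k + 1) - (k + 1) * v * t ^ k|
        ≤ 1 * ((k + 1) ^ 2 * v ^ 2) := mul_le_mul h ih (abs_nonneg _) zero_le_one
    have h3 : ((k : ℝ) + 1) * v ^ 2 * t ^ k ≤ (k + 1) * v ^ 2 * 1 := by gcongr
    push_cast
    nlinarith [sq_nonneg v, mul_nonneg (Nat.cast_nonneg (α := ℝ) k) (sq_nonneg v)]

/-- A second order expansion of the moments of a centred Gaussian in its variance. -/
theorem abs_gaussMoment_increment_le (n : ℕ) {t v : ℝ} (ht : 0 ≤ t) (hv : 0 ≤ v)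
    (h : t + v ≤ 1) :
    |gaussMoment (n + 2) * (t + v) ^ ((n + 2) / 2) - gaussMoment (n + 2) * t ^ ((n + 2) / 2)
        - (n + 2).choose 2 * v * (gaussMoment n * t ^ (n / 2))|
      ≤ gaussMoment (n + 2) * (n + 2) ^ 2 * v ^ 2 := by
  have hd : (n + 2) / 2 = n / 2 + 1 := by omega
  have e : gaussMoment (n + 2) * (t + v) ^ ((n + 2) / 2) - gaussMoment (n + 2) * t ^ ((n + 2) / 2)
        - (n + 2).choose 2 * v * (gaussMoment n * t ^ (n / 2))
      = gaussMoment (n + 2) * ((t + v) ^ (n / 2 + 1) - t ^ (n / 2 + 1)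
        - ((n / 2 : ℕ) + 1) * v * t ^ (n / 2)) := by
    have := choose_mul_gaussMoment n
    rw [hd] at this ⊢
    push_cast at this
    linear_combination (-v * t ^ (n / 2)) * this
  have hg := gaussMoment_nonneg (n + 2)
  rw [e, abs_mul, abs_of_nonneg hg, mul_assoc (gaussMoment _) (_ ^ 2)]
  refine mul_le_mul_of_nonneg_left ?_ hg
  refine (abs_add_pow_sub_le _ ht hv h).trans ?_
  gcongr
  · exact_mod_cast Nat.div_le_self n 2
  · norm_num

/-- Keeping two factors for the variance and one for ε makes every higher moment an error
proportional to the variance, so that errors can be summed over the coordinates. -/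
theorem abs_expect_pow_le {V : Type*} [Fintype V] (h : V → ℝ) {ε : ℝ} (hε1 : ε ≤ 1)
    (hb : ∀ v, |h v| ≤ ε) (j : ℕ) : |𝔼 v, h v ^ (j + 3)| ≤ ε * 𝔼 v, h v ^ 2 := by
  rw [Finset.mul_expect]
  refine (Finset.abs_expect_le _ _).trans (Finset.expect_le_expect fun v _ => ?_)
  have h0 : 0 ≤ |h v| := abs_nonneg _
  rw [abs_pow, ← sq_abs (h v), show j + 3 = j + 1 + 2 by ring, pow_add, pow_succ]
  have : |h v| ^ j ≤ 1 := pow_le_one₀ h0 ((hb v).trans hε1)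
  have h3 : |h v| ^ j * |h v| ≤ 1 * ε := mul_le_mul this (hb v) h0 zero_le_one
  rw [one_mul] at h3
  gcongr

/-- Quantitative convergence of moments in the central limit theorem: moments of a sum of
independent, centred, uniformly small random variables of total variance at most one. -/
theorem exists_abs_expect_sum_pow_sub_le.{u, w} (l : ℕ) :
    ∃ C : ℝ, 0 ≤ C ∧ ∀ (I : Type u) (V : Type w) [Fintype I] [DecidableEq I] [Fintype V] [Nonempty V]
      (h : I → V → ℝ) (ε : ℝ), 0 ≤ ε → ε ≤ 1 → (∀ k v, |h k v| ≤ ε) → (∀ k, 𝔼 v, h k v = 0) →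
      ∀ s : Finset I, ∑ k ∈ s, 𝔼 v, h k v ^ 2 ≤ 1 →
      |𝔼 ω : I → V, (∑ k ∈ s, h k (ω k)) ^ l
          - gaussMoment l * (∑ k ∈ s, 𝔼 v, h k v ^ 2) ^ (l / 2)|
        ≤ C * ε * ∑ k ∈ s, 𝔼 v, h k v ^ 2 := by
  induction l using Nat.strong_induction_on with
  | _ l ih =>
  match l, ih with
  | 0, _ =>
    refine ⟨0, le_rfl, ?_⟩
    intros; simp [gaussMoment]
  | 1, _ =>
    refine ⟨0, le_rfl, ?_⟩
    intro I V _ _ _ _ h ε _ _ _ hc s _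
    simp only [pow_one, Finset.expect_sum_comm, gaussMoment, zero_mul, sub_zero]
    rw [Finset.sum_eq_zero fun k _ => by rw [expect_comp_eval k (h k), hc k]]
    simp
  | n + 2, ih =>
    choose! C hC0 hC using ih
    -- The three summands pay for the moments of order at least three of the new variable, the
    -- inductive error at order n in the quadratic term, and the Taylor remainder in the variance.
    refine ⟨∑ j ∈ Finset.range n, ((n + 2).choose (j + 3) : ℝ)
        * (gaussMoment (n + 2 - (j + 3)) + C (n + 2 - (j + 3)))
      + (n + 2).choose 2 * C n + gaussMoment (n + 2) * (n + 2) ^ 2, ?_, ?_⟩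
    · have h1 : ∀ j ∈ Finset.range n, 0 ≤ ((n + 2).choose (j + 3) : ℝ)
          * (gaussMoment (n + 2 - (j + 3)) + C (n + 2 - (j + 3))) := fun j hj =>
        mul_nonneg (Nat.cast_nonneg _)
          (add_nonneg (gaussMoment_nonneg _) (hC0 _ (by omega)))
      have h2 := Finset.sum_nonneg h1
      have h3 := hC0 n (by omega)
      have h4 := gaussMoment_nonneg (n + 2)
      positivity
    · intro I V _ _ _ _ h ε hε0 hε1 hb hc s
      induction s using Finset.induction_on with
      | empty => intro _; simp
      | insert a s ha ihs =>
        intro hs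
        rw [Finset.sum_insert ha] at hs ⊢
        have hv0 : 0 ≤ 𝔼 v, h a v ^ 2 := Finset.expect_nonneg fun _ _ => sq_nonneg _
        have ht0 : 0 ≤ ∑ k ∈ s, 𝔼 v, h k v ^ 2 :=
          Finset.sum_nonneg fun k _ => Finset.expect_nonneg fun _ _ => sq_nonneg _
        have hvε : 𝔼 v, h a v ^ 2 ≤ ε := by
          refine Finset.expect_le Finset.univ_nonempty fun v _ => ?_
          rw [← sq_abs]
          nlinarith [hb a v, abs_nonneg (h a v)]
        have key := ihs (by linarith)
        have hinc := abs_gaussMoment_increment_le n ht0 hv0 (by linarith)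
        have hlow : ∀ j < n + 2, |𝔼 ω : I → V, (∑ k ∈ s, h k (ω k)) ^ j
            - gaussMoment j * (∑ k ∈ s, 𝔼 v, h k v ^ 2) ^ (j / 2)| ≤ C j * ε := by
          intro j hj
          refine (hC j hj I V h ε hε0 hε1 hb hc s (by linarith)).trans ?_
          exact mul_le_of_le_one_right (mul_nonneg (hC0 j hj) hε0) (by linarith)
        have hexp : 𝔼 ω : I → V, (∑ k ∈ insert a s, h k (ω k)) ^ (n + 2)
            = ∑ j ∈ Finset.range (n + 3), (𝔼 v, h a v ^ j)
              * (𝔼 ω : I → V, (∑ k ∈ s, h k (ω k)) ^ (n + 2 - j)) * (n + 2).choose j := by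
          rw [expect_eq_expect_expect_update a]
          have hS : ∀ (ω : I → V) (v : V), ∑ k ∈ insert a s, h k (Function.update ω a v k)
              = h a v + ∑ k ∈ s, h k (ω k) := by
            intro ω v
            rw [Finset.sum_insert ha, Function.update_self]
            congr 1
            refine Finset.sum_congr rfl fun k hk => ?_
            rw [Function.update_of_ne (ne_of_mem_of_not_mem hk ha)]
          simp_rw [hS, add_pow, Finset.expect_sum_comm]
          refine Finset.sum_congr rfl fun j _ => ?_
          rw [mul_comm (𝔼 v, h a v ^ j), Finset.expect_mul, Finset.expect_mul]
          refine Finset.expect_congr rfl fun ω _ => ?_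
          rw [Finset.mul_expect, Finset.expect_mul]
          exact Finset.expect_congr rfl fun v _ => by ring
        have hsplit : 𝔼 ω : I → V, (∑ k ∈ insert a s, h k (ω k)) ^ (n + 2)
            = ∑ j ∈ Finset.range n, (𝔼 v, h a v ^ (j + 3))
              * (𝔼 ω : I → V, (∑ k ∈ s, h k (ω k)) ^ (n + 2 - (j + 3))) * (n + 2).choose (j + 3)
              + (𝔼 v, h a v ^ 2) * (𝔼 ω : I → V, (∑ k ∈ s, h k (ω k)) ^ n) * (n + 2).choose 2
              + 𝔼 ω : I → V, (∑ k ∈ s, h k (ω k)) ^ (n + 2) := by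
          -- The powers 0, 1, 2 of the new variable are split off; the first power drops out by
          -- centredness.
          rw [hexp, Finset.sum_range_succ', Finset.sum_range_succ', Finset.sum_range_succ']
          simp [hc]
        have hhigh : |∑ j ∈ Finset.range n, (𝔼 v, h a v ^ (j + 3))
              * (𝔼 ω : I → V, (∑ k ∈ s, h k (ω k)) ^ (n + 2 - (j + 3))) * (n + 2).choose (j + 3)|
            ≤ (∑ j ∈ Finset.range n, ((n + 2).choose (j + 3) : ℝ)
              * (gaussMoment (n + 2 - (j + 3)) + C (n + 2 - (j + 3)))) * ε * 𝔼 v, h a v ^ 2 := by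
          rw [Finset.sum_mul, Finset.sum_mul]
          refine (Finset.abs_sum_le_sum_abs _ _).trans (Finset.sum_le_sum fun j hj => ?_)
          rw [Finset.mem_range] at hj
          rw [abs_mul, abs_mul, abs_of_nonneg (Nat.cast_nonneg _ : (0 : ℝ) ≤ (n + 2).choose (j + 3))]
          have h1 := abs_expect_pow_le (h a) hε1 (hb a) j
          have h2 := hlow (n + 2 - (j + 3)) (by omega)
          have hg := gaussMoment_nonneg (n + 2 - (j + 3))
          have h3 : |𝔼 ω : I → V, (∑ k ∈ s, h k (ω k)) ^ (n + 2 - (j + 3))|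
              ≤ gaussMoment (n + 2 - (j + 3)) + C (n + 2 - (j + 3)) := by
            have h4 : gaussMoment (n + 2 - (j + 3)) *
                (∑ k ∈ s, 𝔼 v, h k v ^ 2) ^ ((n + 2 - (j + 3)) / 2)
                ≤ gaussMoment (n + 2 - (j + 3)) * 1 :=
              mul_le_mul_of_nonneg_left (pow_le_one₀ ht0 (by linarith)) hg
            have h5 : 0 ≤ gaussMoment (n + 2 - (j + 3)) *
                (∑ k ∈ s, 𝔼 v, h k v ^ 2) ^ ((n + 2 - (j + 3)) / 2) :=
              mul_nonneg hg (pow_nonneg ht0 _)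
            have h6 : C (n + 2 - (j + 3)) * ε ≤ C (n + 2 - (j + 3)) :=
              mul_le_of_le_one_right (hC0 _ (by omega)) hε1
            rw [abs_le] at h2 ⊢
            constructor <;> linarith [h2.1, h2.2]
          calc _ ≤ (ε * 𝔼 v, h a v ^ 2) * (gaussMoment (n + 2 - (j + 3)) + C (n + 2 - (j + 3)))
                * (n + 2).choose (j + 3) := by
                gcongr
            _ = _ := by ring
        have hmid : |(𝔼 v, h a v ^ 2) * (n + 2).choose 2 * (𝔼 ω : I → V, (∑ k ∈ s, h k (ω k)) ^ n
            - gaussMoment n * (∑ k ∈ s, 𝔼 v, h k v ^ 2) ^ (n / 2))|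
            ≤ (n + 2).choose 2 * C n * ε * 𝔼 v, h a v ^ 2 := by
          rw [abs_mul, abs_of_nonneg (by positivity)]
          calc _ ≤ (𝔼 v, h a v ^ 2) * (n + 2).choose 2 * (C n * ε) := by
                gcongr; exact hlow n (by omega)
            _ = _ := by ring
        -- The quadratic remainder becomes linear in the variance, because a single variance is at
        -- most ε.
        have hsq : gaussMoment (n + 2) * (n + 2) ^ 2 * (𝔼 v, h a v ^ 2) ^ 2
            ≤ gaussMoment (n + 2) * (n + 2) ^ 2 * ε * 𝔼 v, h a v ^ 2 := by
          have := gaussMoment_nonneg (n + 2)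
          rw [sq (𝔼 v, h a v ^ 2), mul_assoc _ ε]
          gcongr
        rw [hsplit, add_comm (𝔼 v, h a v ^ 2) (∑ k ∈ s, _)]
        have := hinc.trans hsq
        generalize (∑ j ∈ Finset.range n, (𝔼 v, h a v ^ (j + 3))
              * (𝔼 ω : I → V, (∑ k ∈ s, h k (ω k)) ^ (n + 2 - (j + 3)))
              * ((n + 2).choose (j + 3) : ℝ)) = H at *
        generalize (∑ j ∈ Finset.range n, ((n + 2).choose (j + 3) : ℝ)
              * (gaussMoment (n + 2 - (j + 3)) + C (n + 2 - (j + 3)))) = K at *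
        rw [abs_le] at *
        constructor <;> linarith [hhigh.1, hhigh.2, hmid.1, hmid.2, this.1, this.2, key.1, key.2]

/-! ### The Hoeffding decomposition of the count, its mean and its variance. -/

section Kernel

set_option linter.unusedSectionVars false

variable {F : Type*} [Field F] [Fintype F] [DecidableEq F]

/-- The real indicator function of `A`. -/
noncomputable def memInd (A : Finset F) (u : F) : ℝ := if u ∈ A then 1 else 0

/-- The density of `A` in `F`. -/
noncomputable def density (A : Finset F) : ℝ := (Fintype.card F : ℝ)⁻¹ * A.card

/-- The real indicator function of the zero vector. -/
noncomputable def zeroInd {r : ℕ} (x : Fin r → F) : ℝ := if x = 0 then 1 else 0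

/-- The probability that a uniform vector of length `r` is zero. -/
noncomputable def zeroProb (F : Type*) [Fintype F] (r : ℕ) : ℝ := ((Fintype.card F : ℝ) ^ r)⁻¹

/-- The completely degenerate part of the kernel `(x, y) ↦ 1_A (x ⬝ y)`. -/
noncomputable def resKernel (A : Finset F) {r : ℕ} (x y : Fin r → F) : ℝ :=
  memInd A (x ⬝ᵥ y) - density A + gammaA A * (zeroInd x + zeroInd y - zeroProb F r)

theorem gammaA_eq (A : Finset F) : gammaA A = density A - memInd A 0 := rfl

theorem memInd_nonneg (A : Finset F) (u : F) : 0 ≤ memInd A u := by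
  unfold memInd; split_ifs <;> norm_num

theorem memInd_le_one (A : Finset F) (u : F) : memInd A u ≤ 1 := by
  unfold memInd; split_ifs <;> norm_num

theorem memInd_sq (A : Finset F) (u : F) : memInd A u ^ 2 = memInd A u := by
  unfold memInd; split_ifs <;> norm_num

theorem zeroInd_nonneg {r : ℕ} (x : Fin r → F) : 0 ≤ zeroInd x := by
  unfold zeroInd; split_ifs <;> norm_num

theorem zeroInd_le_one {r : ℕ} (x : Fin r → F) : zeroInd x ≤ 1 := by
  unfold zeroInd; split_ifs <;> norm_num

theorem zeroInd_sq {r : ℕ} (x : Fin r → F) : zeroInd x ^ 2 = zeroInd x := by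
  unfold zeroInd; split_ifs <;> norm_num

theorem density_pos {A : Finset F} (hA : A.Nonempty) : 0 < density A := by
  have h1 : (0 : ℝ) < Fintype.card F := by exact_mod_cast Fintype.card_pos
  have h2 : (0 : ℝ) < A.card := by exact_mod_cast hA.card_pos
  unfold density; positivity

theorem density_nonneg (A : Finset F) : 0 ≤ density A := by
  unfold density; positivity

theorem density_lt_one {A : Finset F} (hA : A ≠ Finset.univ) : density A < 1 := by
  have h1 : (0 : ℝ) < Fintype.card F := by exact_mod_cast Fintype.card_pos
  have h2 : (A.card : ℝ) < Fintype.card F := by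
    exact_mod_cast (Finset.card_lt_iff_ne_univ A).2 hA
  unfold density
  rwa [inv_mul_lt_iff₀ h1, mul_one]

theorem density_le_one (A : Finset F) : density A ≤ 1 := by
  have h1 : (0 : ℝ) < Fintype.card F := by exact_mod_cast Fintype.card_pos
  have h2 : (A.card : ℝ) ≤ Fintype.card F := by exact_mod_cast Finset.card_le_univ A
  unfold density
  rwa [inv_mul_le_iff₀ h1, mul_one]

theorem gammaA_ne_zero {A : Finset F} (hA : A.Nonempty) (hA' : A ≠ Finset.univ) :
    gammaA A ≠ 0 := by
  have h1 := density_pos hA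
  have h2 := density_lt_one hA'
  rw [gammaA_eq]
  unfold memInd
  split_ifs <;> intro h <;> linarith

theorem abs_gammaA_le_one (A : Finset F) : |gammaA A| ≤ 1 := by
  have h1 := density_nonneg A
  have h2 := density_le_one A
  have h3 := memInd_nonneg A 0
  have h4 := memInd_le_one A 0
  rw [gammaA_eq, abs_le]
  constructor <;> linarith

theorem abs_memInd_sub_density_le (A : Finset F) (u : F) : |memInd A u - density A| ≤ 1 := by
  have h1 := density_nonneg A
  have h2 := density_le_one A
  have h3 := memInd_nonneg A u
  have h4 := memInd_le_one A u
  rw [abs_le]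
  constructor <;> linarith

variable (F) in
theorem zeroProb_pos (r : ℕ) : 0 < zeroProb F r := by
  have h1 : (0 : ℝ) < Fintype.card F := by exact_mod_cast Fintype.card_pos
  unfold zeroProb; positivity

variable (F) in
theorem zeroProb_le_one (r : ℕ) : zeroProb F r ≤ 1 := by
  have h1 : (1 : ℝ) ≤ Fintype.card F := by exact_mod_cast Fintype.card_pos
  exact inv_le_one_of_one_le₀ (one_le_pow₀ h1)

variable (F) in
theorem zeroProb_le_half {r : ℕ} (hr : 0 < r) : zeroProb F r ≤ 1 / 2 := by
  have h1 : (2 : ℝ) ≤ Fintype.card F := by exact_mod_cast Fintype.one_lt_card (α := F)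
  have h2 : (2 : ℝ) ≤ (Fintype.card F : ℝ) ^ r :=
    h1.trans (le_self_pow₀ (by linarith) hr.ne')
  rw [zeroProb, one_div]
  exact inv_anti₀ (by norm_num) h2

theorem abs_resKernel_le (A : Finset F) {r : ℕ} (x y : Fin r → F) : |resKernel A x y| ≤ 3 := by
  have h1 := abs_memInd_sub_density_le A (x ⬝ᵥ y)
  have h2 : |zeroInd x + zeroInd y - zeroProb F r| ≤ 2 := by
    have := zeroInd_nonneg x
    have := zeroInd_nonneg y
    have := zeroInd_le_one x
    have := zeroInd_le_one y
    have := zeroProb_pos F r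
    have := zeroProb_le_one F r
    rw [abs_le]; constructor <;> linarith
  have h3 := mul_le_mul (abs_gammaA_le_one A) h2 (abs_nonneg _) zero_le_one
  rw [← abs_mul] at h3
  exact (abs_add_le _ _).trans (by linarith)

theorem resKernel_comm (A : Finset F) {r : ℕ} (x y : Fin r → F) :
    resKernel A x y = resKernel A y x := by
  unfold resKernel
  rw [dotProduct_comm, add_comm (zeroInd x)]

theorem expect_memInd (A : Finset F) : 𝔼 u, memInd A u = density A := by
  rw [Fintype.expect_eq_sum_div_card]
  simp [memInd, density, div_eq_inv_mul]

theorem expect_zeroInd (r : ℕ) : 𝔼 x : Fin r → F, zeroInd x = zeroProb F r := by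
  rw [Fintype.expect_eq_sum_div_card]
  simp [zeroInd, zeroProb]

/-- Randomizing `y` along a coordinate where `x` is nonzero already makes the dot product uniform.
-/
theorem expect_comp_dotProduct {r : ℕ} {x : Fin r → F} (hx : x ≠ 0) (φ : F → ℝ) :
    𝔼 y : Fin r → F, φ (x ⬝ᵥ y) = 𝔼 u, φ u := by
  obtain ⟨a, ha⟩ := Function.ne_iff.1 hx
  rw [expect_eq_expect_expect_add (fun c : F => Pi.single a ((x a)⁻¹ * c))]
  have h : ∀ y : Fin r → F, 𝔼 c, φ (x ⬝ᵥ (y + Pi.single a ((x a)⁻¹ * c))) = 𝔼 u, φ u := by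
    intro y
    refine Fintype.expect_equiv (Equiv.addLeft (x ⬝ᵥ y)) _ _ fun c => ?_
    rw [dotProduct_add, dotProduct_single, mul_inv_cancel_left₀ ha]
    rfl
  simp_rw [h, Fintype.expect_const]

theorem expect_memInd_dotProduct (A : Finset F) {r : ℕ} (x : Fin r → F) :
    𝔼 y : Fin r → F, memInd A (x ⬝ᵥ y) = density A - gammaA A * zeroInd x := by
  by_cases hx : x = 0
  · subst hx
    simp [gammaA_eq, zeroInd]
  · rw [expect_comp_dotProduct hx (memInd A), expect_memInd]
    simp [zeroInd, hx]

theorem expect_resKernel_right (A : Finset F) {r : ℕ} (x : Fin r → F) :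
    𝔼 y, resKernel A x y = 0 := by
  unfold resKernel
  rw [Finset.expect_add_distrib, Finset.expect_sub_distrib, ← Finset.mul_expect,
    Finset.expect_sub_distrib, Finset.expect_add_distrib, expect_memInd_dotProduct, expect_zeroInd]
  simp only [Fintype.expect_const]
  ring

theorem expect_resKernel_left (A : Finset F) {r : ℕ} (y : Fin r → F) :
    𝔼 x, resKernel A x y = 0 := by
  simp_rw [resKernel_comm A _ y, expect_resKernel_right]

/-- The centred count, as a function of the rows of the left factor and the columns of the right
factor. -/
noncomputable def centredCount (A : Finset F) {m n r : ℕ} (x : Fin m → Fin r → F)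
    (y : Fin n → Fin r → F) : ℝ :=
  ∑ i, ∑ j, (memInd A (x i ⬝ᵥ y j) - (density A - zeroProb F r * gammaA A))

theorem ct_sub_muA (A : Finset F) {m n r : ℕ} (x : Fin m → Fin r → F) (y : Fin n → Fin r → F) :
    (ct A (Matrix.of x * (Matrix.of y).transpose) : ℝ)
      - muA A m n r = centredCount A x y := by
  unfold ct centredCount muA
  rw [Finset.card_filter, Fintype.sum_prod_type]
  push_cast
  simp_rw [Finset.sum_sub_distrib]
  simp only [Finset.sum_const, Finset.card_univ, Fintype.card_fin, nsmul_eq_mul]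
  have : ∀ i j, memInd A (x i ⬝ᵥ y j) = if (Matrix.of x * (Matrix.of y).transpose) i j ∈ A then 1 else 0 := fun _ _ => rfl
  simp_rw [this, density, zeroProb]
  ring

/-- The Hoeffding decomposition; each row deviation is counted once per column and vice versa,
whence the weights n and m. -/
theorem centredCount_eq (A : Finset F) {m n r : ℕ} (x : Fin m → Fin r → F)
    (y : Fin n → Fin r → F) :
    centredCount A x y = ∑ i, ∑ j, resKernel A (x i) (y j)
      + (∑ i, n * gammaA A * (zeroProb F r - zeroInd (x i))
        + ∑ j, m * gammaA A * (zeroProb F r - zeroInd (y j))) := by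
  have e1 : ∑ i, (n : ℝ) * gammaA A * (zeroProb F r - zeroInd (x i))
      = ∑ i, ∑ _j : Fin n, gammaA A * (zeroProb F r - zeroInd (x i)) := by
    simp [mul_assoc]
  have e2 : ∑ j, (m : ℝ) * gammaA A * (zeroProb F r - zeroInd (y j))
      = ∑ _i : Fin m, ∑ j, gammaA A * (zeroProb F r - zeroInd (y j)) := by
    simp [mul_assoc, Finset.mul_sum]
  rw [e1, e2, ← Finset.sum_add_distrib, ← Finset.sum_add_distrib]
  refine Finset.sum_congr rfl fun i _ => ?_
  rw [← Finset.sum_add_distrib, ← Finset.sum_add_distrib]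
  refine Finset.sum_congr rfl fun j _ => ?_
  unfold resKernel
  ring

theorem expect_zeroProb_sub_zeroInd (r : ℕ) : 𝔼 x : Fin r → F, (zeroProb F r - zeroInd x) = 0 := by
  rw [Finset.expect_sub_distrib, expect_zeroInd, Fintype.expect_const, sub_self]

theorem expect_zeroProb_sub_zeroInd_sq (r : ℕ) :
    𝔼 x : Fin r → F, (zeroProb F r - zeroInd x) ^ 2 = zeroProb F r * (1 - zeroProb F r) := by
  have h : ∀ x : Fin r → F, (zeroProb F r - zeroInd x) ^ 2
      = zeroProb F r ^ 2 + (1 - 2 * zeroProb F r) * zeroInd x := fun x => by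
    linear_combination zeroInd_sq x
  simp_rw [h]
  rw [Finset.expect_add_distrib, ← Finset.mul_expect, expect_zeroInd, Fintype.expect_const]
  ring

theorem abs_zeroProb_sub_zeroInd_le {r : ℕ} (x : Fin r → F) : |zeroProb F r - zeroInd x| ≤ 1 := by
  have := zeroInd_nonneg x
  have := zeroInd_le_one x
  have := zeroProb_pos F r
  have := zeroProb_le_one F r
  rw [abs_le]; constructor <;> linarith

theorem expect_centred_right (A : Finset F) {r : ℕ} (x : Fin r → F) :
    𝔼 y : Fin r → F, (memInd A (x ⬝ᵥ y) - (density A - zeroProb F r * gammaA A))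
      = gammaA A * (zeroProb F r - zeroInd x) := by
  rw [Finset.expect_sub_distrib, expect_memInd_dotProduct, Fintype.expect_const]
  ring

theorem expect_centredCount (A : Finset F) (m n r : ℕ) :
    𝔼 x : Fin m → Fin r → F, 𝔼 y : Fin n → Fin r → F, centredCount A x y = 0 := by
  unfold centredCount
  simp_rw [Finset.expect_sum_comm]
  refine Finset.sum_eq_zero fun i _ => Finset.sum_eq_zero fun j _ => ?_
  have h : ∀ x : Fin m → Fin r → F, 𝔼 y : Fin n → Fin r → F,
      (memInd A (x i ⬝ᵥ y j) - (density A - zeroProb F r * gammaA A))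
      = gammaA A * (zeroProb F r - zeroInd (x i)) := fun x => by
    rw [← expect_centred_right]
    exact expect_comp_eval j fun v =>
      memInd A (x i ⬝ᵥ v) - (density A - zeroProb F r * gammaA A)
  simp_rw [h]
  rw [← Finset.mul_expect, expect_comp_eval i fun v => zeroProb F r - zeroInd v,
    expect_zeroProb_sub_zeroInd, mul_zero]

theorem expect_expect_centred_sq (A : Finset F) (r : ℕ) :
    𝔼 x : Fin r → F, 𝔼 y : Fin r → F,
      (memInd A (x ⬝ᵥ y) - (density A - zeroProb F r * gammaA A)) ^ 2
      = (density A - zeroProb F r * gammaA A) * (1 - (density A - zeroProb F r * gammaA A)) := by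
  have h : ∀ x y : Fin r → F, (memInd A (x ⬝ᵥ y) - (density A - zeroProb F r * gammaA A)) ^ 2
      = (density A - zeroProb F r * gammaA A) ^ 2
        + (1 - 2 * (density A - zeroProb F r * gammaA A)) * memInd A (x ⬝ᵥ y) := fun x y => by
    linear_combination memInd_sq A (x ⬝ᵥ y)
  simp_rw [h, Finset.expect_add_distrib, ← Finset.mul_expect, expect_memInd_dotProduct,
    Finset.expect_sub_distrib, ← Finset.mul_expect, expect_zeroInd, Fintype.expect_const]
  ring

theorem expect_expect_expect_centred_mul (A : Finset F) (r : ℕ) :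
    𝔼 x : Fin r → F, 𝔼 y : Fin r → F, 𝔼 z : Fin r → F,
      (memInd A (x ⬝ᵥ y) - (density A - zeroProb F r * gammaA A))
        * (memInd A (x ⬝ᵥ z) - (density A - zeroProb F r * gammaA A))
      = zeroProb F r * (1 - zeroProb F r) * gammaA A ^ 2 := by
  simp_rw [← Finset.mul_expect, expect_centred_right, ← Finset.expect_mul, expect_centred_right]
  rw [← expect_zeroProb_sub_zeroInd_sq, Finset.expect_mul]
  exact Finset.expect_congr rfl fun x _ => by ring

/-- Entries sharing only a row are conditionally independent given that row, so their covariance is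
the variance of the conditional mean; the same holds for columns. The term with factor 2 cancels the
row and column contributions on the diagonal, where all three conditions hold. -/
theorem expect_centred_mul_centred (A : Finset F) {m n r : ℕ} (i i' : Fin m) (j j' : Fin n) :
    𝔼 x : Fin m → Fin r → F, 𝔼 y : Fin n → Fin r → F,
      (memInd A (x i ⬝ᵥ y j) - (density A - zeroProb F r * gammaA A))
        * (memInd A (x i' ⬝ᵥ y j') - (density A - zeroProb F r * gammaA A))
      = (if i = i' then (if j = j' then (density A - zeroProb F r * gammaA A)
          * (1 - (density A - zeroProb F r * gammaA A))
          - 2 * (zeroProb F r * (1 - zeroProb F r) * gammaA A ^ 2) else 0) else 0)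
        + (if i = i' then zeroProb F r * (1 - zeroProb F r) * gammaA A ^ 2 else 0)
        + (if j = j' then zeroProb F r * (1 - zeroProb F r) * gammaA A ^ 2 else 0) := by
  set w : (Fin r → F) → (Fin r → F) → ℝ := fun x y =>
    memInd A (x ⬝ᵥ y) - (density A - zeroProb F r * gammaA A) with hw
  have hcomm : ∀ x y, w x y = w y x := fun x y => by simp only [hw, dotProduct_comm]
  change 𝔼 x : Fin m → Fin r → F, 𝔼 y : Fin n → Fin r → F, w (x i) (y j) * w (x i') (y j') = _
  rcases eq_or_ne i i' with rfl | hi <;> rcases eq_or_ne j j' with rfl | hj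
  · have h : ∀ x : Fin m → Fin r → F, 𝔼 y : Fin n → Fin r → F, w (x i) (y j) * w (x i) (y j)
        = 𝔼 v, w (x i) v ^ 2 := fun x => by
      rw [← expect_comp_eval j fun v => w (x i) v ^ 2]
      simp_rw [sq]
    simp_rw [h]
    rw [expect_comp_eval i fun u => 𝔼 v, w u v ^ 2, expect_expect_centred_sq]
    simp
    ring
  · have h : ∀ x : Fin m → Fin r → F, 𝔼 y : Fin n → Fin r → F, w (x i) (y j) * w (x i) (y j')
        = 𝔼 v, 𝔼 z, w (x i) v * w (x i) z := fun x =>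
      expect_comp_eval_eval hj fun v z => w (x i) v * w (x i) z
    simp_rw [h]
    rw [expect_comp_eval i fun u => 𝔼 v, 𝔼 z, w u v * w u z, expect_expect_expect_centred_mul]
    simp [hj]
  · rw [Finset.expect_comm]
    have h : ∀ y : Fin n → Fin r → F, 𝔼 x : Fin m → Fin r → F, w (x i) (y j) * w (x i') (y j)
        = 𝔼 v, 𝔼 z, w (y j) v * w (y j) z := fun y => by
      simp_rw [hcomm _ (y j)]
      exact expect_comp_eval_eval hi fun v z => w (y j) v * w (y j) z
    simp_rw [h]
    rw [expect_comp_eval j fun u => 𝔼 v, 𝔼 z, w u v * w u z, expect_expect_expect_centred_mul]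
    simp [hi]
  · have h : ∀ x : Fin m → Fin r → F, 𝔼 y : Fin n → Fin r → F, w (x i) (y j) * w (x i') (y j')
        = (gammaA A * (zeroProb F r - zeroInd (x i)))
          * (gammaA A * (zeroProb F r - zeroInd (x i'))) := fun x => by
      rw [expect_comp_eval_eval hj fun v z => w (x i) v * w (x i') z]
      simp_rw [← Finset.mul_expect, ← Finset.expect_mul, hw, expect_centred_right]
    simp_rw [h]
    rw [expect_comp_eval_eval hi fun v z => (gammaA A * (zeroProb F r - zeroInd v))
          * (gammaA A * (zeroProb F r - zeroInd z))]
    simp_rw [← Finset.mul_expect, expect_zeroProb_sub_zeroInd]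
    simp [hi, hj]

theorem expect_centredCount_sq (A : Finset F) (m n r : ℕ) :
    𝔼 x : Fin m → Fin r → F, 𝔼 y : Fin n → Fin r → F, centredCount A x y ^ 2
      = sigmaSqA A m n r := by
  have h : ∀ (x : Fin m → Fin r → F) (y : Fin n → Fin r → F), centredCount A x y ^ 2
      = ∑ i, ∑ j, ∑ i', ∑ j', (memInd A (x i ⬝ᵥ y j) - (density A - zeroProb F r * gammaA A))
        * (memInd A (x i' ⬝ᵥ y j') - (density A - zeroProb F r * gammaA A)) := fun x y => by
    unfold centredCount
    simp_rw [sq, Finset.sum_mul, Finset.mul_sum]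
  simp_rw [h, Finset.expect_sum_comm, expect_centred_mul_centred]
  simp only [Finset.sum_add_distrib, Finset.sum_ite_irrel, Finset.sum_const_zero,
    Finset.sum_ite_eq, Finset.mem_univ, if_true, Finset.sum_const, Finset.card_univ,
    Fintype.card_fin, nsmul_eq_mul]
  simp only [sigmaSqA, density, zeroProb]
  ring

theorem sigmaSqA_pos {A : Finset F} (hA : A.Nonempty) (hA' : A ≠ Finset.univ) {m n r : ℕ}
    (hm : 0 < m) (hn : 0 < n) (hr : 0 < r) : 0 < sigmaSqA A m n r := by
  have hm' : (1 : ℝ) ≤ m := by exact_mod_cast hm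
  have hn' : (1 : ℝ) ≤ n := by exact_mod_cast hn
  have h1 := density_pos hA
  have h2 := density_lt_one hA'
  have h3 := zeroProb_pos F r
  have h4 := zeroProb_le_half F hr
  have h5 := memInd_nonneg A 0
  have h6 := memInd_le_one A 0
  have e : sigmaSqA A m n r = m * n * ((density A - zeroProb F r * gammaA A)
      * (1 - (density A - zeroProb F r * gammaA A)))
      + m * n * ((m - 1) + (n - 1)) * (zeroProb F r * (1 - zeroProb F r)) * gammaA A ^ 2 := by
    simp only [sigmaSqA, density, zeroProb]; ring
  -- This probability is the convex combination (1 - p) d + p 1_A(0), and p ≤ 1/2 gives d positive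
  -- weight; this is where r ≥ 1 enters.
  have h7 : 0 < density A - zeroProb F r * gammaA A := by
    rw [gammaA_eq]; nlinarith
  have h8 : 0 < 1 - (density A - zeroProb F r * gammaA A) := by
    rw [gammaA_eq]; nlinarith
  have h9 : 0 ≤ (m - 1 : ℝ) + (n - 1) := by linarith
  have h10 : 0 ≤ 1 - zeroProb F r := by linarith
  rw [e]
  positivity

end Kernel

/-! ### Moments of the degenerate part: counting index tuples and comparing with independent
entries. -/

theorem abs_prod_sub_prod_le {S : Type*} (s : Finset S) (a b : S → ℝ) {M : ℝ} (hM : 1 ≤ M)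
    (ha : ∀ i, |a i| ≤ M) (hb : ∀ i, |b i| ≤ M) :
    |∏ i ∈ s, a i - ∏ i ∈ s, b i| ≤ M ^ s.card * ∑ i ∈ s, |a i - b i| := by
  classical
  have hM0 : 0 ≤ M := by linarith
  induction s using Finset.induction_on with
  | empty => simp
  | insert k s hk ih =>
    rw [Finset.prod_insert hk, Finset.prod_insert hk, Finset.sum_insert hk,
      Finset.card_insert_of_notMem hk]
    have e : a k * ∏ i ∈ s, a i - b k * ∏ i ∈ s, b i
        = a k * (∏ i ∈ s, a i - ∏ i ∈ s, b i) + (a k - b k) * ∏ i ∈ s, b i := by ring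
    have h1 : |∏ i ∈ s, b i| ≤ M ^ s.card := by
      rw [Finset.abs_prod]
      exact (Finset.prod_le_prod (fun _ _ => abs_nonneg _) fun i _ => hb i).trans_eq
        (Finset.prod_const M)
    have h2 : M ^ s.card ≤ M ^ (s.card + 1) := pow_le_pow_right₀ hM (Nat.le_succ _)
    rw [e]
    calc _ ≤ |a k| * |∏ i ∈ s, a i - ∏ i ∈ s, b i| + |a k - b k| * |∏ i ∈ s, b i| := by
          rw [← abs_mul, ← abs_mul]; exact abs_add_le _ _
      _ ≤ M * (M ^ s.card * ∑ i ∈ s, |a i - b i|) + |a k - b k| * M ^ (s.card + 1) := by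
          have := ha k
          have := h1.trans h2
          gcongr
      _ = _ := by ring

/-- A product of functions of independent coordinates averages to zero if it contains a centred
factor whose coordinate is not used by the other factors. -/
theorem expect_prod_eq_zero {I V : Type*} [Fintype I] [DecidableEq I] [Fintype V] [Nonempty V]
    {l : ℕ} (t : Fin l → I) (K : Fin l → V → ℝ) (s₀ : Fin l) (hK : 𝔼 v, K s₀ v = 0)
    (ht : ∀ s, s ≠ s₀ → t s ≠ t s₀) : 𝔼 x : I → V, ∏ s, K s (x (t s)) = 0 := by
  rw [expect_eq_expect_expect_update (t s₀)]
  refine Finset.expect_eq_zero fun x _ => ?_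
  have h : ∀ v, ∏ s, K s (Function.update x (t s₀) v (t s))
      = K s₀ v * ∏ s ∈ Finset.univ.erase s₀, K s (x (t s)) := fun v => by
    rw [← Finset.mul_prod_erase _ _ (Finset.mem_univ s₀), Function.update_self]
    congr 1
    refine Finset.prod_congr rfl fun s hs => ?_
    rw [Function.update_of_ne (ht s (Finset.ne_of_mem_erase hs))]
  simp_rw [h, ← Finset.expect_mul, hK, zero_mul]

/-- Maps out of `Fin l` none of whose nonempty fibres is a singleton. -/
def NoSingletonFibre {l : ℕ} {κ : Type*} (t : Fin l → κ) : Prop :=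
  ∀ s, ∃ s', s' ≠ s ∧ t s' = t s

-- Fibres of size at least two leave at most l/2 values, so the map factors through a set of l/2
-- colours; the two factors are then counted freely.
open Classical in
theorem card_noSingletonFibre_le (l m : ℕ) :
    (Finset.univ.filter fun t : Fin l → Fin m => NoSingletonFibre t).card
      ≤ (l / 2) ^ l * m ^ (l / 2) := by
  have hsub : (Finset.univ.filter fun t : Fin l → Fin m => NoSingletonFibre t)
      ⊆ (Finset.univ : Finset ((Fin l → Fin (l / 2)) × (Fin (l / 2) → Fin m))).image
        fun z => z.2 ∘ z.1 := by
    intro t ht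
    have ht : NoSingletonFibre t := by simpa using ht
    have hcard : (Finset.univ.image t).card ≤ l / 2 := by
      have := Finset.mul_card_image_le_card (f := t) Finset.univ 2 (by
        intro k hk
        obtain ⟨s, -, rfl⟩ := Finset.mem_image.1 hk
        obtain ⟨s', hs', hts⟩ := ht s
        exact Finset.one_lt_card.2 ⟨s', by simpa using hts, s, by simp, hs'⟩)
      rw [Finset.card_univ, Fintype.card_fin] at this
      omega
    obtain ⟨e⟩ : Nonempty ((Finset.univ.image t : Finset (Fin m)) ↪ Fin (l / 2)) := by
      rw [Function.Embedding.nonempty_iff_card_le, Fintype.card_coe, Fintype.card_fin]; exact hcard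
    let c : Fin l → Fin (l / 2) := fun s => e ⟨t s, Finset.mem_image_of_mem t (Finset.mem_univ s)⟩
    rcases Nat.eq_zero_or_pos l with rfl | hl
    · exact Finset.mem_image.2 ⟨(c, fun k => k.elim0), Finset.mem_univ _, funext fun s => s.elim0⟩
    -- Unused colours receive an arbitrary value of `t`, which exists as l > 0.
    · refine Finset.mem_image.2 ⟨(c, Function.extend c t fun _ => t ⟨0, hl⟩), Finset.mem_univ _, ?_⟩
      funext s
      simp only [Function.comp_apply]
      refine Function.FactorsThrough.extend_apply (f := c) (g := t) (fun a b hab => ?_) _ s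
      simpa using congrArg Subtype.val (e.injective hab)
  refine (Finset.card_le_card hsub).trans (Finset.card_image_le.trans ?_)
  simp

section Comparison

set_option linter.unusedSectionVars false

variable {F : Type*} [Field F] [Fintype F] [DecidableEq F]

theorem exists_dual_of_linearIndependent {F : Type*} [Field F] {J : Type*} [Fintype J]
    [DecidableEq J] {r : ℕ} {y : J → Fin r → F} (hy : LinearIndependent F y) :
    ∃ Z : J → Fin r → F, ∀ j' j, Z j' ⬝ᵥ y j = if j' = j then 1 else 0 := by
  obtain ⟨g, hg⟩ := (Fintype.linearCombination F y).exists_leftInverse_of_injective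
    (LinearMap.ker_eq_bot.2 hy.fintypeLinearCombination_injective)
  refine ⟨LinearMap.toMatrix' g, fun j' j => ?_⟩
  have h1 : (LinearMap.toMatrix' g).mulVec (y j) = g (y j) := LinearMap.toMatrix'_mulVec g (y j)
  have h2 : g (y j) = Pi.single j 1 := by
    have := LinearMap.congr_fun hg (Pi.single j 1)
    simpa [Fintype.linearCombination_apply_single] using this
  have h3 := congrFun (h1.trans h2) j'
  rw [Pi.single_apply] at h3
  exact h3

/-- If the columns that occur are linearly independent, then the entries of the product are
independent and uniform. -/
theorem expect_prod_dotProduct_eq {m n r l : ℕ} (t : Fin l → Fin m × Fin n)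
    (y : Fin n → Fin r → F)
    (hy : LinearIndependent F fun j : Finset.univ.image (fun s => (t s).2) => y j)
    (h : F → ℝ) :
    𝔼 x : Fin m → Fin r → F, ∏ s, h (x (t s).1 ⬝ᵥ y (t s).2)
      = 𝔼 U : Fin m × Fin n → F, ∏ s, h (U (t s)) := by
  obtain ⟨Z, hZ⟩ := exists_dual_of_linearIndependent hy
  -- By duality, shifting row i by the combination of the `Z j` with coefficients `U (i, j)` adds
  -- exactly `U (i, j)` to its product with column j.
  rw [expect_eq_expect_expect_add (fun (U : Fin m × Fin n → F) (i : Fin m) =>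
    ∑ j : Finset.univ.image (fun s => (t s).2), U (i, j) • Z j)]
  have key : ∀ x : Fin m → Fin r → F,
      𝔼 U : Fin m × Fin n → F, ∏ s, h ((x + fun i =>
        ∑ j : Finset.univ.image (fun s => (t s).2), U (i, j) • Z j) (t s).1 ⬝ᵥ y (t s).2)
      = 𝔼 U : Fin m × Fin n → F, ∏ s, h (U (t s)) := by
    intro x
    refine Fintype.expect_equiv
      (Equiv.addLeft fun k : Fin m × Fin n => x k.1 ⬝ᵥ y k.2) _ _ fun U => ?_
    refine Finset.prod_congr rfl fun s _ => ?_
    congr 1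
    have hZs : ∀ j, Z j ⬝ᵥ y (t s).2 = if j = ⟨(t s).2, Finset.mem_image_of_mem
        (fun s => (t s).2) (Finset.mem_univ s)⟩ then 1 else 0 := fun j => hZ j ⟨(t s).2, _⟩
    rw [Pi.add_apply, add_dotProduct, sum_dotProduct]
    simp_rw [smul_dotProduct, hZs]
    simp
  simp_rw [key, Fintype.expect_const]

/-- A nontrivial combination of independent uniform vectors is uniform, as one sees by randomizing a
vector with nonzero coefficient. -/
theorem expect_zeroInd_sum_smul {J : Type*} [Fintype J] [DecidableEq J] {n r : ℕ}
    (e : J → Fin n) (he : Function.Injective e) {c : J → F} (hc : c ≠ 0) :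
    𝔼 y : Fin n → Fin r → F, zeroInd (∑ j, c j • y (e j)) = zeroProb F r := by
  obtain ⟨k, hk⟩ := Function.ne_iff.1 hc
  rw [expect_eq_expect_expect_add (fun v : Fin r → F => Pi.single (e k) ((c k)⁻¹ • v))]
  have key : ∀ y : Fin n → Fin r → F, 𝔼 v : Fin r → F, zeroInd (∑ j, c j •
      (y + Pi.single (e k) ((c k)⁻¹ • v) : Fin n → Fin r → F) (e j)) = zeroProb F r := by
    intro y
    rw [← expect_zeroInd r]
    refine Fintype.expect_equiv (Equiv.addLeft (∑ j, c j • y (e j))) _ _ fun v => ?_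
    congr 1
    simp only [Pi.add_apply, smul_add, Finset.sum_add_distrib, Equiv.coe_addLeft]
    congr 1
    rw [Finset.sum_eq_single k]
    · rw [Pi.single_eq_same, smul_inv_smul₀ hk]
    · intro j _ hj
      rw [Pi.single_eq_of_ne (he.ne hj), smul_zero]
    · simp
  simp_rw [key, Fintype.expect_const]

open Classical in
/-- Few uniformly random vectors are linearly dependent only with small probability. -/
theorem expect_not_linearIndependent_le {n r : ℕ} (J : Finset (Fin n)) :
    𝔼 y : Fin n → Fin r → F, (if LinearIndependent F (fun j : J => y j) then (0 : ℝ) else 1)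
      ≤ (Fintype.card F : ℝ) ^ J.card * zeroProb F r := by
  have h1 : ∀ y : Fin n → Fin r → F,
      (if LinearIndependent F (fun j : J => y j) then (0 : ℝ) else 1)
      ≤ ∑ c ∈ (Finset.univ.erase (0 : J → F)), zeroInd (∑ j, c j • y j) := by
    intro y
    split_ifs with h
    · exact Finset.sum_nonneg fun _ _ => zeroInd_nonneg _
    · obtain ⟨c, hc, k, hk⟩ := Fintype.not_linearIndependent_iff.1 h
      have hc0 : c ≠ 0 := fun h0 => hk (by rw [h0]; rfl)
      have := Finset.single_le_sum (f := fun c : J → F => zeroInd (∑ j, c j • y j))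
        (fun _ _ => zeroInd_nonneg _) (Finset.mem_erase.2 ⟨hc0, Finset.mem_univ c⟩)
      refine le_trans ?_ this
      rw [hc, zeroInd, if_pos rfl]
  refine (Finset.expect_le_expect fun y _ => h1 y).trans ?_
  rw [Finset.expect_sum_comm]
  have h2 : ∀ c ∈ (Finset.univ.erase (0 : J → F)),
      𝔼 y : Fin n → Fin r → F, zeroInd (∑ j, c j • y j) = zeroProb F r := fun c hc =>
    expect_zeroInd_sum_smul (fun j : J => (j : Fin n)) Subtype.val_injective
      (Finset.ne_of_mem_erase hc)
  rw [Finset.sum_congr rfl h2, Finset.sum_const, nsmul_eq_mul]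
  have hp := (zeroProb_pos F r).le
  gcongr
  have : (Finset.univ.erase (0 : J → F)).card ≤ Fintype.card F ^ J.card := by
    refine (Finset.card_erase_le).trans_eq ?_
    simp
  exact_mod_cast this

/-- For fixed columns the difference is zero when the columns used are independent and at most 2
otherwise; at most l columns are used. -/
theorem abs_expect_prod_dotProduct_sub_le {m n r l : ℕ} (t : Fin l → Fin m × Fin n)
    {h : F → ℝ} (hh : ∀ u, |h u| ≤ 1) :
    |𝔼 x : Fin m → Fin r → F, 𝔼 y : Fin n → Fin r → F, ∏ s, h (x (t s).1 ⬝ᵥ y (t s).2)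
        - 𝔼 U : Fin m × Fin n → F, ∏ s, h (U (t s))|
      ≤ 2 * (Fintype.card F : ℝ) ^ l * zeroProb F r := by
  classical
  rw [Finset.expect_comm]
  have hq : (1 : ℝ) ≤ Fintype.card F := by exact_mod_cast Fintype.card_pos
  have hp := (zeroProb_pos F r).le
  have hprod : ∀ a : Fin l → F, |∏ s, h (a s)| ≤ 1 := fun a => by
    rw [Finset.abs_prod]
    exact Finset.prod_le_one (fun _ _ => abs_nonneg _) fun s _ => hh _
  have h1 : ∀ y : Fin n → Fin r → F,
      |𝔼 x : Fin m → Fin r → F, ∏ s, h (x (t s).1 ⬝ᵥ y (t s).2)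
        - 𝔼 U : Fin m × Fin n → F, ∏ s, h (U (t s))|
      ≤ 2 * (if LinearIndependent F (fun j : Finset.univ.image (fun s => (t s).2) => y j)
          then (0 : ℝ) else 1) := by
    intro y
    split_ifs with hy
    · rw [expect_prod_dotProduct_eq t y hy h]; simp
    · refine (abs_sub _ _).trans ?_
      have e1 : |𝔼 x : Fin m → Fin r → F, ∏ s, h (x (t s).1 ⬝ᵥ y (t s).2)| ≤ 1 :=
        (Finset.abs_expect_le _ _).trans
          (Finset.expect_le Finset.univ_nonempty fun x _ => hprod _)
      have e2 : |𝔼 U : Fin m × Fin n → F, ∏ s, h (U (t s))| ≤ 1 :=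
        (Finset.abs_expect_le _ _).trans
          (Finset.expect_le Finset.univ_nonempty fun x _ => hprod _)
      linarith
  have h2 : 𝔼 y : Fin n → Fin r → F, 𝔼 x : Fin m → Fin r → F, ∏ s, h (x (t s).1 ⬝ᵥ y (t s).2)
        - 𝔼 U : Fin m × Fin n → F, ∏ s, h (U (t s))
      = 𝔼 y : Fin n → Fin r → F, (𝔼 x : Fin m → Fin r → F, ∏ s, h (x (t s).1 ⬝ᵥ y (t s).2)
        - 𝔼 U : Fin m × Fin n → F, ∏ s, h (U (t s))) := by
    rw [Finset.expect_sub_distrib, Fintype.expect_const]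
  rw [h2]
  refine (Finset.abs_expect_le _ _).trans ((Finset.expect_le_expect fun y _ => h1 y).trans ?_)
  rw [← Finset.mul_expect, mul_assoc]
  refine mul_le_mul_of_nonneg_left ((expect_not_linearIndependent_le _).trans ?_) two_pos.le
  gcongr
  exact Finset.card_image_le.trans (by simp)

theorem abs_expect_prod_resKernel_sub_le (A : Finset F) {m n r l : ℕ}
    (t : Fin l → Fin m × Fin n) :
    |𝔼 x : Fin m → Fin r → F, 𝔼 y : Fin n → Fin r → F,
          ∏ s, resKernel A (x (t s).1) (y (t s).2)
        - 𝔼 U : Fin m × Fin n → F, ∏ s, (memInd A (U (t s)) - density A)|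
      ≤ (3 ^ l * (l * 3) + 2 * (Fintype.card F : ℝ) ^ l) * zeroProb F r := by
  have hB := abs_expect_prod_dotProduct_sub_le (r := r) t (abs_memInd_sub_density_le A)
  have hp := (zeroProb_pos F r).le
  have hpt : ∀ x y : Fin r → F,
      |resKernel A x y - (memInd A (x ⬝ᵥ y) - density A)| ≤ zeroInd x + zeroInd y + zeroProb F r := by
    intro x y
    have e : resKernel A x y - (memInd A (x ⬝ᵥ y) - density A)
        = gammaA A * (zeroInd x + zeroInd y - zeroProb F r) := by unfold resKernel; ring
    have h1 := zeroInd_nonneg x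
    have h2 := zeroInd_nonneg y
    rw [e, abs_mul]
    have h3 : |zeroInd x + zeroInd y - zeroProb F r| ≤ zeroInd x + zeroInd y + zeroProb F r := by
      rw [abs_le]; constructor <;> linarith
    calc _ ≤ 1 * (zeroInd x + zeroInd y + zeroProb F r) :=
          mul_le_mul (abs_gammaA_le_one A) h3 (abs_nonneg _) zero_le_one
      _ = _ := one_mul _
  have hA : |𝔼 x : Fin m → Fin r → F, 𝔼 y : Fin n → Fin r → F,
          ∏ s, resKernel A (x (t s).1) (y (t s).2)
        - 𝔼 x : Fin m → Fin r → F, 𝔼 y : Fin n → Fin r → F,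
          ∏ s, (memInd A (x (t s).1 ⬝ᵥ y (t s).2) - density A)|
      ≤ 3 ^ l * (l * 3) * zeroProb F r := by
    simp_rw [← Finset.expect_sub_distrib]
    calc _ ≤ 𝔼 x : Fin m → Fin r → F, 𝔼 y : Fin n → Fin r → F, 3 ^ l *
            ∑ s, (zeroInd (x (t s).1) + zeroInd (y (t s).2) + zeroProb F r) := by
          refine (Finset.abs_expect_le _ _).trans (Finset.expect_le_expect fun x _ => ?_)
          refine (Finset.abs_expect_le _ _).trans (Finset.expect_le_expect fun y _ => ?_)
          refine (abs_prod_sub_prod_le Finset.univ _ _ (M := 3) (by norm_num)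
            (fun s => abs_resKernel_le A _ _)
            (fun s => (abs_memInd_sub_density_le A _).trans (by norm_num))).trans ?_
          rw [Finset.card_univ, Fintype.card_fin]
          gcongr with s _
          exact hpt _ _
      _ = 3 ^ l * (l * 3) * zeroProb F r := by
          have hx : ∀ i : Fin m, 𝔼 x : Fin m → Fin r → F, zeroInd (x i) = zeroProb F r := fun i => by
            rw [expect_comp_eval i zeroInd, expect_zeroInd]
          have hy : ∀ j : Fin n, 𝔼 y : Fin n → Fin r → F, zeroInd (y j) = zeroProb F r := fun j => by
            rw [expect_comp_eval j zeroInd, expect_zeroInd]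
          simp_rw [← Finset.mul_expect, Finset.expect_sum_comm, Finset.expect_add_distrib,
            Fintype.expect_const, hx, hy]
          simp
          ring
  refine (abs_sub_le _ _ _).trans ((add_le_add hA hB).trans_eq (by ring))

theorem expect_prod_resKernel_eq_zero (A : Finset F) {m n r l : ℕ} (t : Fin l → Fin m × Fin n)
    (ht : ¬ (NoSingletonFibre (fun s => (t s).1) ∧ NoSingletonFibre fun s => (t s).2)) :
    𝔼 x : Fin m → Fin r → F, 𝔼 y : Fin n → Fin r → F,
      ∏ s, resKernel A (x (t s).1) (y (t s).2) = 0 := by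
  rw [not_and_or] at ht
  rcases ht with ht | ht <;> simp only [NoSingletonFibre, not_forall, not_exists, not_and] at ht <;>
    obtain ⟨s₀, hs⟩ := ht
  · rw [Finset.expect_comm]
    exact Finset.expect_eq_zero fun y _ => expect_prod_eq_zero (fun s => (t s).1)
      (fun s v => resKernel A v (y (t s).2)) s₀ (expect_resKernel_left A _) hs
  · exact Finset.expect_eq_zero fun x _ => expect_prod_eq_zero (fun s => (t s).2)
      (fun s v => resKernel A (x (t s).1) v) s₀ (expect_resKernel_right A _) hs

theorem expect_prod_memInd_eq_zero (A : Finset F) {m n l : ℕ} (t : Fin l → Fin m × Fin n)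
    (ht : ¬ (NoSingletonFibre (fun s => (t s).1) ∧ NoSingletonFibre fun s => (t s).2)) :
    𝔼 U : Fin m × Fin n → F, ∏ s, (memInd A (U (t s)) - density A) = 0 := by
  have h0 : 𝔼 u, (memInd A u - density A) = 0 := by
    rw [Finset.expect_sub_distrib, expect_memInd, Fintype.expect_const, sub_self]
  rw [not_and_or] at ht
  rcases ht with ht | ht <;> simp only [NoSingletonFibre, not_forall, not_exists, not_and] at ht <;>
    obtain ⟨s₀, hs⟩ := ht
  · exact expect_prod_eq_zero t (fun _ u => memInd A u - density A) s₀ h0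
      fun s hne he => hs s hne (by rw [he])
  · exact expect_prod_eq_zero t (fun _ u => memInd A u - density A) s₀ h0
      fun s hne he => hs s hne (by rw [he])

/-- A tuple of positions is determined by its row and column tuples, so the surviving tuples are
bounded by the product of the two counts. -/
theorem abs_sum_le_of_noSingletonFibre {m n l : ℕ} (G : (Fin l → Fin m × Fin n) → ℝ) {B : ℝ}
    (hB0 : 0 ≤ B) (hB : ∀ t, |G t| ≤ B)
    (hG : ∀ t, ¬ (NoSingletonFibre (fun s => (t s).1) ∧ NoSingletonFibre fun s => (t s).2) →
      G t = 0) :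
    |∑ t, G t| ≤ (((l / 2) ^ l) ^ 2 : ℕ) * B * ((m : ℝ) * n) ^ (l / 2) := by
  classical
  set S := Finset.univ.filter fun t : Fin l → Fin m × Fin n =>
    NoSingletonFibre (fun s => (t s).1) ∧ NoSingletonFibre fun s => (t s).2 with hS
  have h1 : ∑ t, G t = ∑ t ∈ S, G t := by
    refine (Finset.sum_subset (Finset.subset_univ S) fun t _ ht => hG t ?_).symm
    simpa [hS] using ht
  have hcard : S.card ≤ ((l / 2) ^ l * m ^ (l / 2)) * ((l / 2) ^ l * n ^ (l / 2)) := by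
    refine le_trans ?_ (Nat.mul_le_mul (card_noSingletonFibre_le l m) (card_noSingletonFibre_le l n))
    rw [← Finset.card_product]
    refine Finset.card_le_card_of_injOn (fun t => (fun s => (t s).1, fun s => (t s).2)) ?_ ?_
    · intro t ht
      simpa [hS] using ht
    · intro t _ t' _ htt
      rw [Prod.mk.injEq] at htt
      funext s
      exact Prod.ext (congrFun htt.1 s) (congrFun htt.2 s)
  rw [h1]
  calc |∑ t ∈ S, G t| ≤ ∑ t ∈ S, B :=
        (Finset.abs_sum_le_sum_abs _ _).trans (Finset.sum_le_sum fun t _ => hB t)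
    _ = S.card * B := by rw [Finset.sum_const, nsmul_eq_mul]
    _ ≤ (((l / 2) ^ l * m ^ (l / 2)) * ((l / 2) ^ l * n ^ (l / 2)) : ℕ) * B := by
        gcongr
    _ = _ := by push_cast; rw [mul_pow]; ring

theorem expect_sum_resKernel_pow (A : Finset F) (m n r l : ℕ) :
    𝔼 x : Fin m → Fin r → F, 𝔼 y : Fin n → Fin r → F, (∑ i, ∑ j, resKernel A (x i) (y j)) ^ l
      = ∑ t : Fin l → Fin m × Fin n, 𝔼 x : Fin m → Fin r → F, 𝔼 y : Fin n → Fin r → F,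
        ∏ s, resKernel A (x (t s).1) (y (t s).2) := by
  have h : ∀ (x : Fin m → Fin r → F) (y : Fin n → Fin r → F),
      (∑ i, ∑ j, resKernel A (x i) (y j)) ^ l
      = ∑ t : Fin l → Fin m × Fin n, ∏ s, resKernel A (x (t s).1) (y (t s).2) := fun x y => by
    rw [← Fintype.sum_prod_type', Fintype.sum_pow]
  simp_rw [h, Finset.expect_sum_comm]

/-- The moments of the degenerate part agree, up to an error governed by `zeroProb F r`, with those
of a sum of `m n` independent centred Bernoulli variables. -/
theorem exists_abs_expect_sum_resKernel_pow_sub_le (A : Finset F) (l : ℕ) :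
    ∃ C : ℝ, 0 ≤ C ∧ ∀ m n r : ℕ,
      |𝔼 x : Fin m → Fin r → F, 𝔼 y : Fin n → Fin r → F, (∑ i, ∑ j, resKernel A (x i) (y j)) ^ l
        - 𝔼 U : Fin m × Fin n → F, (∑ k, (memInd A (U k) - density A)) ^ l|
      ≤ C * ((m : ℝ) * n) ^ (l / 2) * zeroProb F r := by
  refine ⟨(((l / 2) ^ l) ^ 2 : ℕ) * (3 ^ l * (l * 3) + 2 * (Fintype.card F : ℝ) ^ l),
    by positivity, fun m n r => ?_⟩
  have h : 𝔼 U : Fin m × Fin n → F, (∑ k, (memInd A (U k) - density A)) ^ l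
      = ∑ t : Fin l → Fin m × Fin n,
        𝔼 U : Fin m × Fin n → F, ∏ s, (memInd A (U (t s)) - density A) := by
    simp_rw [Fintype.sum_pow, Finset.expect_sum_comm]
  rw [expect_sum_resKernel_pow, h, ← Finset.sum_sub_distrib]
  have hp := zeroProb_pos F r
  refine (abs_sum_le_of_noSingletonFibre _ (by positivity)
    (fun t => abs_expect_prod_resKernel_sub_le A t) fun t ht => ?_).trans_eq (by ring)
  rw [expect_prod_resKernel_eq_zero A t ht, expect_prod_memInd_eq_zero A t ht, sub_self]

/-- Needed when the linear part dominates: there r may stay bounded, so p need not be small and the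
Bernoulli comparison gives no limit, but the order of magnitude suffices. -/
theorem exists_abs_expect_sum_resKernel_pow_le (A : Finset F) (l : ℕ) :
    ∃ C : ℝ, 0 ≤ C ∧ ∀ m n r : ℕ,
      |𝔼 x : Fin m → Fin r → F, 𝔼 y : Fin n → Fin r → F, (∑ i, ∑ j, resKernel A (x i) (y j)) ^ l|
      ≤ C * ((m : ℝ) * n) ^ (l / 2) := by
  refine ⟨(((l / 2) ^ l) ^ 2 : ℕ) * 3 ^ l, by positivity, fun m n r => ?_⟩
  rw [expect_sum_resKernel_pow]
  refine abs_sum_le_of_noSingletonFibre _ (by positivity) (fun t => ?_)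
    (fun t ht => expect_prod_resKernel_eq_zero A t ht)
  refine (Finset.abs_expect_le _ _).trans (Finset.expect_le Finset.univ_nonempty fun x _ => ?_)
  refine (Finset.abs_expect_le _ _).trans (Finset.expect_le Finset.univ_nonempty fun y _ => ?_)
  rw [Finset.abs_prod]
  refine (Finset.prod_le_prod (fun _ _ => abs_nonneg _)
    fun s _ => abs_resKernel_le A _ _).trans_eq ?_
  simp

end Comparison

/-! ### Limit theorems for moments. -/

theorem expect_prod_type {α β : Type*} [Fintype α] [Fintype β] (f : α × β → ℝ) :
    𝔼 z, f z = 𝔼 x, 𝔼 y, f (x, y) := by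
  rw [← Finset.univ_product_univ, Finset.expect_product]

theorem tendsto_zero_of_sq_tendsto_zero {ι : Type*} {l : Filter ι} {u : ι → ℝ}
    (h : Tendsto (fun i => u i ^ 2) l (𝓝 0)) : Tendsto u l (𝓝 0) := by
  rw [tendsto_zero_iff_abs_tendsto_zero]
  simpa [Real.sqrt_sq_eq_abs, Function.comp_def] using h.sqrt

/-- Convergence of all moments to Gaussian moments is stable under perturbations all of whose
moments tend to zero. -/
theorem tendsto_expect_add_pow {ι : Type*} {l : Filter ι} {Ω : ι → Type*} [∀ i, Fintype (Ω i)]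
    (a b : ∀ i, Ω i → ℝ)
    (ha : ∀ k, Tendsto (fun i => 𝔼 ω, a i ω ^ k) l (𝓝 (gaussMoment k)))
    (hb : ∀ k, 0 < k → Tendsto (fun i => 𝔼 ω, b i ω ^ (2 * k)) l (𝓝 0)) (k : ℕ) :
    Tendsto (fun i => 𝔼 ω, (a i ω + b i ω) ^ k) l (𝓝 (gaussMoment k)) := by
  -- By Cauchy–Schwarz a mixed moment is controlled by an even moment of `b`, which vanishes in the
  -- limit, times an even moment of `a`, which converges.
  have hab : ∀ j s, 0 < j → Tendsto (fun i => 𝔼 ω, b i ω ^ j * a i ω ^ s) l (𝓝 0) := by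
    intro j s hj
    refine tendsto_zero_of_sq_tendsto_zero ?_
    have h := (hb j hj).mul (ha (s * 2))
    rw [zero_mul] at h
    refine squeeze_zero (fun i => sq_nonneg _) (fun i => ?_) h
    refine (Finset.expect_mul_sq_le_sq_mul_sq _ _ _).trans_eq ?_
    simp_rw [← pow_mul, mul_comm j 2]
  have h : ∀ i, 𝔼 ω, (a i ω + b i ω) ^ k
      = ∑ j ∈ Finset.range k, (𝔼 ω, b i ω ^ (j + 1) * a i ω ^ (k - (j + 1))) * k.choose (j + 1)
        + 𝔼 ω, a i ω ^ k := by
    intro i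
    simp_rw [add_comm (a i _), add_pow, Finset.sum_range_succ', Finset.expect_add_distrib,
      Finset.expect_sum_comm, ← Finset.expect_mul]
    simp
  simp_rw [h]
  have h2 : Tendsto (fun i => ∑ j ∈ Finset.range k,
      (𝔼 ω, b i ω ^ (j + 1) * a i ω ^ (k - (j + 1))) * (k.choose (j + 1) : ℝ)) l (𝓝 0) := by
    have := tendsto_finsetSum (Finset.range k) fun j _ =>
      (hab (j + 1) (k - (j + 1)) j.succ_pos).mul_const (k.choose (j + 1) : ℝ)
    simpa using this
  simpa using h2.add (ha k)

/-- Convergence of moments for row-wise independent triangular arrays of uniformly small variables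
with unit total variance. -/
theorem tendsto_expect_sum_pow {ι : Type*} {l : Filter ι} {I V : ι → Type*} [∀ i, Fintype (I i)]
    [∀ i, DecidableEq (I i)] [∀ i, Fintype (V i)] [∀ i, Nonempty (V i)]
    (h : ∀ i, I i → V i → ℝ) (ε : ι → ℝ) (hε : Tendsto ε l (𝓝 0)) (hε0 : ∀ i, 0 ≤ ε i)
    (hb : ∀ i k v, |h i k v| ≤ ε i) (hc : ∀ i k, 𝔼 v, h i k v = 0)
    (hv : ∀ i, ∑ k, 𝔼 v, h i k v ^ 2 = 1) (k : ℕ) :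
    Tendsto (fun i => 𝔼 ω : I i → V i, (∑ a, h i a (ω a)) ^ k) l (𝓝 (gaussMoment k)) := by
  obtain ⟨C, -, hC⟩ := exists_abs_expect_sum_pow_sub_le k
  rw [tendsto_iff_dist_tendsto_zero]
  have h1 : ∀ᶠ i in l, ε i ≤ 1 := hε.eventually_le_const one_pos
  refine squeeze_zero' (Eventually.of_forall fun _ => dist_nonneg) ?_
    (by simpa using hε.const_mul C)
  filter_upwards [h1] with i hi
  have := hC (I i) (V i) (h i) (ε i) (hε0 i) hi (hb i) (hc i) Finset.univ (hv i).le
  rw [hv i] at this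
  simpa [Real.dist_eq] using this

/-! ### The two asymptotic regimes: dominant degenerate part and dominant linear part. -/

section Asymptotics

variable {F : Type*} [Field F] [Fintype F] [DecidableEq F]

/-- The hypothesis at k = 2 says that σ²/c² tends to 1, so `c` can be replaced by σ. -/
theorem tendsto_expect_centredCount_div_sqrt {ι : Type*} {l : Filter ι} (A : Finset F)
    (m n r : ι → ℕ) (c : ι → ℝ) (hc : ∀ i, 0 < c i)
    (h : ∀ k, Tendsto (fun i => 𝔼 z : (Fin (m i) → Fin (r i) → F) × (Fin (n i) → Fin (r i) → F),
      (centredCount A z.1 z.2 / c i) ^ k) l (𝓝 (gaussMoment k))) (k : ℕ) :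
    Tendsto (fun i => 𝔼 z : (Fin (m i) → Fin (r i) → F) × (Fin (n i) → Fin (r i) → F),
      (centredCount A z.1 z.2 / √(sigmaSqA A (m i) (n i) (r i))) ^ k) l (𝓝 (gaussMoment k)) := by
  have h2 : Tendsto (fun i => sigmaSqA A (m i) (n i) (r i) / c i ^ 2) l (𝓝 1) := by
    have := h 2
    simp_rw [div_pow, ← Finset.expect_div, expect_prod_type, expect_centredCount_sq] at this
    simpa [gaussMoment] using this
  have h3 : Tendsto (fun i => √(sigmaSqA A (m i) (n i) (r i) / c i ^ 2) ^ k) l (𝓝 1) := by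
    simpa using h2.sqrt.pow k
  have h4 := (h k).div h3 one_ne_zero
  rw [div_one] at h4
  refine h4.congr fun i => ?_
  rw [Pi.div_apply, Finset.expect_div]
  refine Finset.expect_congr rfl fun z _ => ?_
  rw [← div_pow, Real.sqrt_div' _ (sq_nonneg _), Real.sqrt_sq (hc i).le,
    div_div_div_cancel_right₀ (hc i).ne']

theorem sqrt_pow_two_mul {x : ℝ} (hx : 0 ≤ x) (k : ℕ) : √x ^ (2 * k) = x ^ k := by
  rw [pow_mul, Real.sq_sqrt hx]

theorem pow_div_two_le_sqrt_pow {x : ℝ} (hx : 1 ≤ x) (k : ℕ) : x ^ (k / 2) ≤ √x ^ k := by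
  rw [← sqrt_pow_two_mul (by linarith)]
  exact pow_le_pow_right₀ (Real.one_le_sqrt.2 hx) (by omega)

/-- The degenerate part is asymptotically Gaussian as soon as `m`, `n` and `r` grow. -/
theorem tendsto_expect_resKernel_sum_pow {ι : Type*} {l : Filter ι} {A : Finset F}
    (hA : A.Nonempty) (hA' : A ≠ Finset.univ) {m n r : ι → ℕ}
    (hm : ∀ i, 0 < m i) (hn : ∀ i, 0 < n i) (hmt : Tendsto m l atTop)
    (hp : Tendsto (fun i => zeroProb F (r i)) l (𝓝 0)) (k : ℕ) :
    Tendsto (fun i => 𝔼 z : (Fin (m i) → Fin (r i) → F) × (Fin (n i) → Fin (r i) → F),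
      ((∑ a, ∑ b, resKernel A (z.1 a) (z.2 b)) /
        √((m i : ℝ) * n i * (density A * (1 - density A)))) ^ k) l (𝓝 (gaussMoment k)) := by
  have hd0 := density_pos hA
  have hd1 := density_lt_one hA'
  set v := density A * (1 - density A) with hv
  have hv0 : 0 < v := mul_pos hd0 (by linarith)
  have hmn : ∀ i, (1 : ℝ) ≤ (m i : ℝ) * n i := fun i => by
    exact_mod_cast Nat.mul_pos (hm i) (hn i)
  have hc0 : ∀ i, 0 < √((m i : ℝ) * n i * v) := fun i =>
    Real.sqrt_pos.2 (mul_pos (by linarith [hmn i]) hv0)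
  have hvar : 𝔼 u, (memInd A u - density A) ^ 2 = v := by
    have h : ∀ u, (memInd A u - density A) ^ 2
        = density A ^ 2 + (1 - 2 * density A) * memInd A u := fun u => by
      linear_combination memInd_sq A u
    simp_rw [h]
    rw [Finset.expect_add_distrib, ← Finset.mul_expect, expect_memInd, Fintype.expect_const]
    ring
  have hcinv : Tendsto (fun i => (√((m i : ℝ) * n i * v))⁻¹) l (𝓝 0) := by
    refine tendsto_inv_atTop_zero.comp (Real.tendsto_sqrt_atTop.comp ?_)
    refine Tendsto.atTop_mul_const hv0 ?_
    refine tendsto_atTop_mono (fun i => ?_) (tendsto_natCast_atTop_atTop.comp hmt)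
    exact le_mul_of_one_le_right (Nat.cast_nonneg _) (by exact_mod_cast hn i)
  have hU := tendsto_expect_sum_pow (l := l) (I := fun i => Fin (m i) × Fin (n i))
    (V := fun _ => F) (fun i _ u => (memInd A u - density A) / √((m i : ℝ) * n i * v))
    (fun i => (√((m i : ℝ) * n i * v))⁻¹) hcinv (fun i => (inv_pos.2 (hc0 i)).le)
    (fun i _ u => by
      rw [abs_div, abs_of_pos (hc0 i), div_eq_mul_inv]
      exact mul_le_of_le_one_left (inv_pos.2 (hc0 i)).le (abs_memInd_sub_density_le A u))
    (fun i _ => by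
      rw [← Finset.expect_div, Finset.expect_sub_distrib, expect_memInd, Fintype.expect_const,
        sub_self, zero_div])
    (fun i => by
      simp_rw [div_pow, ← Finset.expect_div, hvar,
        Real.sq_sqrt (mul_pos (by linarith [hmn i]) hv0 : 0 < (m i : ℝ) * n i * v).le]
      have := hmn i
      simp only [Finset.sum_const, Finset.card_univ, Fintype.card_prod, Fintype.card_fin,
        nsmul_eq_mul, Nat.cast_mul]
      rw [← mul_div_assoc, div_self (by positivity)]) k
  obtain ⟨C, hC0, hC⟩ := exists_abs_expect_sum_resKernel_pow_sub_le A k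
  have hdiff : Tendsto (fun i =>
      𝔼 z : (Fin (m i) → Fin (r i) → F) × (Fin (n i) → Fin (r i) → F),
        ((∑ a, ∑ b, resKernel A (z.1 a) (z.2 b)) / √((m i : ℝ) * n i * v)) ^ k
      - 𝔼 U : Fin (m i) × Fin (n i) → F,
        (∑ a, (memInd A (U a) - density A) / √((m i : ℝ) * n i * v)) ^ k) l (𝓝 0) := by
    refine squeeze_zero_norm (a := fun i => C / √v ^ k * zeroProb F (r i)) (fun i => ?_)
      (by simpa using hp.const_mul (C / √v ^ k))
    simp_rw [expect_prod_type, ← Finset.sum_div, div_pow, ← Finset.expect_div, ← sub_div]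
    rw [Real.norm_eq_abs, abs_div, abs_of_pos (pow_pos (hc0 i) k), div_le_iff₀ (pow_pos (hc0 i) k)]
    refine (hC (m i) (n i) (r i)).trans ?_
    have hsv : 0 < √v ^ k := pow_pos (Real.sqrt_pos.2 hv0) k
    have hp0 := (zeroProb_pos F (r i)).le
    clear_value v
    rw [Real.sqrt_mul (by linarith [hmn i] : 0 ≤ (m i : ℝ) * n i) v, mul_pow (√_) (√v)]
    calc C * ((m i : ℝ) * n i) ^ (k / 2) * zeroProb F (r i)
        ≤ C * √((m i : ℝ) * n i) ^ k * zeroProb F (r i) := by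
          gcongr
          exact pow_div_two_le_sqrt_pow (hmn i) k
      _ = _ := by field_simp
  simpa using hdiff.add hU

/-- Zero vectors are rare here. Taking ε = 1 in the quantitative limit theorem gives no Gaussian
limit, but its error is proportional to the variance, hence O(mp) for every even moment. -/
theorem exists_expect_zeroInd_sum_pow_le (F : Type*) [Field F] [Fintype F] [DecidableEq F] (k : ℕ)
    (hk : 0 < k) :
    ∃ C : ℝ, 0 ≤ C ∧ ∀ m r : ℕ, (m : ℝ) * zeroProb F r ≤ 1 →
      𝔼 x : Fin m → Fin r → F, (∑ a, (zeroProb F r - zeroInd (x a))) ^ (2 * k)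
        ≤ C * (m * zeroProb F r) := by
  obtain ⟨C, hC0, hC⟩ := exists_abs_expect_sum_pow_sub_le (2 * k)
  have hg := gaussMoment_nonneg (2 * k)
  refine ⟨gaussMoment (2 * k) + C, by positivity, fun m r hmr => ?_⟩
  have hp0 := zeroProb_pos F r
  have hp1 := zeroProb_le_one F r
  have hs : ∑ _a : Fin m, 𝔼 v : Fin r → F, (zeroProb F r - zeroInd v) ^ 2
      = m * (zeroProb F r * (1 - zeroProb F r)) := by
    simp [expect_zeroProb_sub_zeroInd_sq]
  have hle : (m : ℝ) * (zeroProb F r * (1 - zeroProb F r)) ≤ m * zeroProb F r := by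
    gcongr
    exact mul_le_of_le_one_right hp0.le (by linarith)
  have h0 : 0 ≤ (m : ℝ) * (zeroProb F r * (1 - zeroProb F r)) := by
    have : 0 ≤ 1 - zeroProb F r := by linarith
    positivity
  have h := hC (Fin m) (Fin r → F) (fun _ v => zeroProb F r - zeroInd v) 1 zero_le_one le_rfl
    (fun _ v => abs_zeroProb_sub_zeroInd_le v) (fun _ => expect_zeroProb_sub_zeroInd r)
    Finset.univ (by rw [hs]; linarith)
  rw [hs] at h
  have h1 : ((m : ℝ) * (zeroProb F r * (1 - zeroProb F r))) ^ (2 * k / 2)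
      ≤ m * (zeroProb F r * (1 - zeroProb F r)) :=
    pow_le_of_le_one h0 (by linarith) (by omega)
  have h2 := mul_le_mul_of_nonneg_left (h1.trans hle) hg
  have h3 := mul_le_mul_of_nonneg_left hle hC0
  have h4 := (abs_le.1 h).2
  simp only [mul_one] at h4
  linarith

/-- The linear part coming from one factor is negligible. -/
theorem tendsto_expect_linear_pow {ι : Type*} {l : Filter ι} {A : Finset F}
    (hA : A.Nonempty) (hA' : A ≠ Finset.univ) {m n r : ι → ℕ}
    (hm : ∀ i, 0 < m i) (hn : ∀ i, 0 < n i)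
    (h : ∀ k : ℕ, Tendsto (fun i => ((n i : ℝ) / m i) ^ k * (m i * zeroProb F (r i))) l (𝓝 0))
    (k : ℕ) (hk : 0 < k) :
    Tendsto (fun i => 𝔼 x : Fin (m i) → Fin (r i) → F,
      ((∑ a, n i * gammaA A * (zeroProb F (r i) - zeroInd (x a))) /
        √((m i : ℝ) * n i * (density A * (1 - density A)))) ^ (2 * k)) l (𝓝 0) := by
  have hd0 := density_pos hA
  have hd1 := density_lt_one hA'
  set v := density A * (1 - density A) with hv
  have hv0 : 0 < v := mul_pos hd0 (by linarith)
  obtain ⟨C, hC0, hC⟩ := exists_expect_zeroInd_sum_pow_le F k hk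
  have hev : ∀ᶠ i in l, (m i : ℝ) * zeroProb F (r i) ≤ 1 := by
    have := h 0
    simp only [pow_zero, one_mul] at this
    exact this.eventually_le_const one_pos
  have hlim := (h k).const_mul ((gammaA A ^ 2 / v) ^ k * C)
  rw [mul_zero] at hlim
  refine squeeze_zero' (Eventually.of_forall fun i => Finset.expect_nonneg fun x _ =>
    Even.pow_nonneg (even_two_mul k) _) ?_ hlim
  filter_upwards [hev] with i hi
  have hm' : (0 : ℝ) < m i := by exact_mod_cast hm i
  have hn' : (0 : ℝ) < n i := by exact_mod_cast hn i
  simp_rw [← Finset.mul_sum, div_pow, mul_pow _ (∑ a, _), ← Finset.expect_div,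
    ← Finset.mul_expect]
  rw [sqrt_pow_two_mul (by positivity)]
  calc _ ≤ ((n i : ℝ) * gammaA A) ^ (2 * k) * (C * (m i * zeroProb F (r i)))
        / ((m i : ℝ) * n i * v) ^ k := by
        have : 0 ≤ ((n i : ℝ) * gammaA A) ^ (2 * k) := Even.pow_nonneg (even_two_mul k) _
        gcongr
        exact hC _ _ hi
    _ = (((n i : ℝ) * gammaA A) ^ 2 / ((m i : ℝ) * n i * v)) ^ k
        * (C * (m i * zeroProb F (r i))) := by
        rw [pow_mul, div_pow]; ring
    _ = ((gammaA A ^ 2 / v) * (n i / m i)) ^ k * (C * (m i * zeroProb F (r i))) := by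
        congr 2
        field_simp
    _ = _ := by rw [mul_pow]; ring

/-- Gaussian moments when the degenerate part dominates. -/
theorem tendsto_expect_of_degenerate_dominant {ι : Type*} {l : Filter ι} {A : Finset F}
    (hA : A.Nonempty) (hA' : A ≠ Finset.univ) {m n r : ι → ℕ}
    (hm : ∀ i, 0 < m i) (hn : ∀ i, 0 < n i) (hmt : Tendsto m l atTop)
    (h1 : ∀ k : ℕ, Tendsto (fun i => ((n i : ℝ) / m i) ^ k * (m i * zeroProb F (r i))) l (𝓝 0))
    (h2 : ∀ k : ℕ, Tendsto (fun i => ((m i : ℝ) / n i) ^ k * (n i * zeroProb F (r i))) l (𝓝 0))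
    (k : ℕ) :
    Tendsto (fun i => 𝔼 z : (Fin (m i) → Fin (r i) → F) × (Fin (n i) → Fin (r i) → F),
      (centredCount A z.1 z.2 / √(sigmaSqA A (m i) (n i) (r i))) ^ k) l (𝓝 (gaussMoment k)) := by
  have hd0 := density_pos hA
  have hd1 := density_lt_one hA'
  have hp : Tendsto (fun i => zeroProb F (r i)) l (𝓝 0) := by
    have := h1 0
    simp only [pow_zero, one_mul] at this
    refine squeeze_zero (fun i => (zeroProb_pos F (r i)).le) (fun i => ?_) this
    exact le_mul_of_one_le_left (zeroProb_pos F (r i)).le (by exact_mod_cast hm i)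
  refine tendsto_expect_centredCount_div_sqrt A m n r
    (fun i => √((m i : ℝ) * n i * (density A * (1 - density A)))) (fun i => ?_) (fun k => ?_) k
  · have hm' : (0 : ℝ) < m i := by exact_mod_cast hm i
    have hn' : (0 : ℝ) < n i := by exact_mod_cast hn i
    have : 0 < 1 - density A := by linarith
    positivity
  · simp_rw [centredCount_eq, add_div]
    simp_rw [← add_assoc]
    -- The row part and then the column part are removed as perturbations.
    refine tendsto_expect_add_pow _ _ (fun k => tendsto_expect_add_pow _ _
      (fun k => tendsto_expect_resKernel_sum_pow hA hA' hm hn hmt hp k) (fun k hk => ?_) k)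
      (fun k hk => ?_) k
    · simp_rw [expect_prod_type, Fintype.expect_const]
      exact tendsto_expect_linear_pow hA hA' hm hn h1 k hk
    · simp_rw [expect_prod_type, Fintype.expect_const, mul_comm (m _ : ℝ) (n _ : ℝ)]
      exact tendsto_expect_linear_pow hA hA' hn hm h2 k hk

/-- Gaussian moments when the linear part dominates. -/
theorem tendsto_expect_of_linear_dominant {ι : Type*} {l : Filter ι} {A : Finset F}
    (hA : A.Nonempty) (hA' : A ≠ Finset.univ) {m n r : ι → ℕ}
    (hm : ∀ i, 0 < m i) (hn : ∀ i, 0 < n i) (hr : ∀ i, 0 < r i)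
    (h : Tendsto (fun i => (Fintype.card F : ℝ) ^ r i / (min (m i) (n i) : ℕ)) l (𝓝 0))
    (k : ℕ) :
    Tendsto (fun i => 𝔼 z : (Fin (m i) → Fin (r i) → F) × (Fin (n i) → Fin (r i) → F),
      (centredCount A z.1 z.2 / √(sigmaSqA A (m i) (n i) (r i))) ^ k) l (𝓝 (gaussMoment k)) := by
  have hγ := gammaA_ne_zero hA hA'
  have hγ2 : 0 < gammaA A ^ 2 := by positivity
  set p : ι → ℝ := fun i => zeroProb F (r i) with hpdef
  have hp0 : ∀ i, 0 < p i := fun i => zeroProb_pos F (r i)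
  have hp1 : ∀ i, 1 / 2 ≤ 1 - p i := fun i => by linarith [zeroProb_le_half F (hr i)]
  have hm' : ∀ i, (0 : ℝ) < m i := fun i => by exact_mod_cast hm i
  have hn' : ∀ i, (0 : ℝ) < n i := fun i => by exact_mod_cast hn i
  have hq : ∀ i, (Fintype.card F : ℝ) ^ r i = (p i)⁻¹ := fun i => (inv_inv _).symm
  -- The variance of the linear part.
  set c2 : ι → ℝ := fun i => gammaA A ^ 2 * (m i * n i * (m i + n i) * (p i * (1 - p i))) with hc2
  have hc2pos : ∀ i, 0 < c2 i := fun i => by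
    have := hp0 i; have := hp1 i; have := hm' i; have := hn' i
    have : 0 < 1 - p i := by linarith
    positivity
  have hcpos : ∀ i, 0 < √(c2 i) := fun i => Real.sqrt_pos.2 (hc2pos i)
  have hmin : ∀ i, (0 : ℝ) < (min (m i) (n i) : ℕ) := fun i => by
    exact_mod_cast lt_min (hm i) (hn i)
  -- The left side is the square of the uniform bound ε used below. One factor 2 comes from 1/m +
  -- 1/n ≤ 2/min, the other from 1 - p ≥ 1/2.
  have hbound : ∀ i, ((m i : ℝ) + n i) / (m i * n i * (p i * (1 - p i)))
      ≤ 4 * ((Fintype.card F : ℝ) ^ r i / (min (m i) (n i) : ℕ)) := by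
    intro i
    have h1 := hp0 i; have h2 := hp1 i; have h3 := hm' i; have h4 := hn' i; have h5 := hmin i
    have h6 : 0 < 1 - p i := by linarith
    have h7 : ((min (m i) (n i) : ℕ) : ℝ) ≤ m i := by exact_mod_cast min_le_left _ _
    have h8 : ((min (m i) (n i) : ℕ) : ℝ) ≤ n i := by exact_mod_cast min_le_right _ _
    have e : 4 * ((p i)⁻¹ / (min (m i) (n i) : ℕ)) * (m i * n i * (p i * (1 - p i)))
        = 4 * (m i * n i * (1 - p i)) / (min (m i) (n i) : ℕ) := by field_simp
    have h9 := mul_le_mul_of_nonneg_left h8 h3.le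
    have h10 := mul_le_mul_of_nonneg_left h7 h4.le
    have h11 := mul_le_mul_of_nonneg_left h2 (mul_pos h3 h4).le
    rw [hq, div_le_iff₀ (by positivity), e, le_div_iff₀ h5]
    linarith
  have hbound' : ∀ i, 1 / (((m i : ℝ) + n i) * (p i * (1 - p i)))
      ≤ 4 * ((Fintype.card F : ℝ) ^ r i / (min (m i) (n i) : ℕ)) := by
    intro i
    have h1 := hp0 i; have h2 := hp1 i; have h3 := hm' i; have h4 := hn' i; have h5 := hmin i
    have h6 : 0 < 1 - p i := by linarith
    have h7 : ((min (m i) (n i) : ℕ) : ℝ) ≤ m i := by exact_mod_cast min_le_left _ _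
    have e : 4 * ((p i)⁻¹ / (min (m i) (n i) : ℕ)) * ((m i + n i) * (p i * (1 - p i)))
        = 4 * ((m i + n i) * (1 - p i)) / (min (m i) (n i) : ℕ) := by field_simp
    have h8 := mul_le_mul_of_nonneg_left h2 (add_pos h3 h4).le
    rw [hq, div_le_iff₀ (by positivity), e, le_div_iff₀ h5]
    linarith
  refine tendsto_expect_centredCount_div_sqrt A m n r (fun i => √(c2 i)) hcpos (fun k => ?_) k
  simp_rw [centredCount_eq, add_div, add_comm ((∑ a, ∑ b, resKernel A _ _) / _)]
  refine tendsto_expect_add_pow _ _ (fun k => ?_) (fun k hk => ?_) k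
  · have hε : Tendsto (fun i => |gammaA A| * ((m i : ℝ) + n i) / √(c2 i)) l (𝓝 0) := by
      refine tendsto_zero_of_sq_tendsto_zero ?_
      have hlim := h.const_mul 4
      rw [mul_zero] at hlim
      refine squeeze_zero (fun i => sq_nonneg _) (fun i => ?_) hlim
      refine le_trans (le_of_eq ?_) (hbound i)
      have h1 := hp0 i; have h2 := hp1 i; have h3 := hm' i; have h4 := hn' i
      have h6 : 0 < 1 - p i := by linarith
      rw [div_pow, mul_pow, sq_abs, Real.sq_sqrt (hc2pos i).le, hc2]
      field_simp
    -- Rows and columns together form one independent family, indexed by the disjoint union.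
    have key := tendsto_expect_sum_pow (l := l) (I := fun i => Fin (m i) ⊕ Fin (n i))
      (V := fun i => Fin (r i) → F)
      (fun i s v => Sum.elim (fun _ => (n i : ℝ)) (fun _ => (m i : ℝ)) s * gammaA A
        * (zeroProb F (r i) - zeroInd v) / √(c2 i))
      (fun i => |gammaA A| * ((m i : ℝ) + n i) / √(c2 i)) hε
      (fun i => by positivity)
      (fun i s v => by
        have h3 := hm' i; have h4 := hn' i
        rw [abs_div, abs_of_pos (hcpos i), abs_mul, abs_mul]
        refine div_le_div_of_nonneg_right ?_ (hcpos i).le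
        have h5 : |Sum.elim (fun _ => (n i : ℝ)) (fun _ => (m i : ℝ)) s| ≤ m i + n i := by
          rcases s with s | s <;> simp
        calc _ ≤ ((m i : ℝ) + n i) * |gammaA A| * 1 := by
              gcongr
              exact abs_zeroProb_sub_zeroInd_le v
          _ = _ := by ring)
      (fun i s => by
        rw [← Finset.expect_div, ← Finset.mul_expect, expect_zeroProb_sub_zeroInd, mul_zero,
          zero_div])
      (fun i => by
        have h1 := hp0 i; have h2 := hp1 i; have h3 := hm' i; have h4 := hn' i
        have h6 : 0 < 1 - p i := by linarith
        simp_rw [div_pow, ← Finset.expect_div, mul_pow, ← Finset.mul_expect,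
          expect_zeroProb_sub_zeroInd_sq, Real.sq_sqrt (hc2pos i).le]
        rw [Fintype.sum_sum_type]
        simp only [Sum.elim_inl, Sum.elim_inr, Finset.sum_const, Finset.card_univ,
          Fintype.card_fin, nsmul_eq_mul]
        rw [← mul_div_assoc, ← mul_div_assoc, ← add_div, div_eq_one_iff_eq (hc2pos i).ne']
        simp only [hc2, hpdef]
        ring) k
    refine key.congr fun i => ?_
    refine Fintype.expect_equiv (Equiv.sumArrowEquivProdArrow _ _ _) _ _ fun ω => ?_
    congr 1
    rw [Fintype.sum_sum_type, Finset.sum_div, Finset.sum_div]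
    rfl
  · obtain ⟨C, hC0, hC⟩ := exists_abs_expect_sum_resKernel_pow_le A (2 * k)
    have hlim := ((h.const_mul 4).pow k).const_mul (C * ((gammaA A ^ 2)⁻¹) ^ k)
    rw [mul_zero, zero_pow hk.ne', mul_zero] at hlim
    refine squeeze_zero (fun i => Finset.expect_nonneg fun x _ =>
      Even.pow_nonneg (even_two_mul k) _) (fun i => ?_) hlim
    have h1 := hp0 i; have h2 := hp1 i; have h3 := hm' i; have h4 := hn' i
    have h6 : 0 < 1 - p i := by linarith
    simp_rw [expect_prod_type, div_pow, ← Finset.expect_div]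
    rw [sqrt_pow_two_mul (hc2pos i).le]
    calc _ ≤ C * ((m i : ℝ) * n i) ^ (2 * k / 2) / c2 i ^ k := by
          have := hc2pos i
          gcongr
          exact (le_abs_self _).trans (hC _ _ _)
      _ = C * ((gammaA A ^ 2)⁻¹) ^ k * (1 / (((m i : ℝ) + n i) * (p i * (1 - p i)))) ^ k := by
          rw [Nat.mul_div_cancel_left k two_pos, mul_div_assoc, ← div_pow, mul_assoc, ← mul_pow]
          congr 2
          simp only [hc2]
          field_simp
      _ ≤ _ := by
          gcongr
          exact hbound' i

end Asymptotics

/-! ### The growth conditions and the conclusion. -/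

theorem tendsto_ratio_pow_mul_of_superpolynomial (F : Type*) [Field F] [Fintype F] [DecidableEq F]
    {ι : Type*} {l : Filter ι} {m n r : ι → ℕ} (hm : ∀ i, 0 < m i)
    (h : ∀ a : ℝ, 0 < a →
      Tendsto (fun i => (Fintype.card F : ℝ) ^ r i / ((m i : ℝ) + n i) ^ a) l atTop) (k : ℕ) :
    Tendsto (fun i => ((n i : ℝ) / m i) ^ k * (m i * zeroProb F (r i))) l (𝓝 0) := by
  -- Since n/m ≤ m + n and m ≤ m + n, the expression is at most (m + n)^(k+1) p.
  have h1 := (h ((k + 1 : ℕ) : ℝ) (by positivity)).inv_tendsto_atTop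
  refine squeeze_zero (fun i => ?_) (fun i => ?_) h1
  · have := (zeroProb_pos F (r i)).le
    positivity
  · have hm' : (1 : ℝ) ≤ m i := by exact_mod_cast hm i
    have hn' : (0 : ℝ) ≤ n i := Nat.cast_nonneg _
    have hp := (zeroProb_pos F (r i)).le
    rw [Pi.inv_apply, inv_div, Real.rpow_natCast, pow_succ, mul_div_assoc]
    change _ ≤ ((m i : ℝ) + n i) ^ k * (((m i : ℝ) + n i) * zeroProb F (r i))
    gcongr
    · exact (div_le_self hn' hm').trans (by linarith)
    · linarith

theorem tendsto_ratio_pow_mul_of_isBigO (F : Type*) [Field F] [Fintype F] [DecidableEq F]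
    {ι : Type*} {l : Filter ι} {m n r : ι → ℕ}
    (h : (fun i => (n i : ℝ)) =O[l] fun i => (m i : ℝ))
    (hp : Tendsto (fun i => m i * zeroProb F (r i)) l (𝓝 0)) (k : ℕ) :
    Tendsto (fun i => ((n i : ℝ) / m i) ^ k * (m i * zeroProb F (r i))) l (𝓝 0) := by
  obtain ⟨C, hC0, hC⟩ := h.exists_nonneg
  have hlim := hp.const_mul (C ^ k)
  rw [mul_zero] at hlim
  refine squeeze_zero' (Eventually.of_forall fun i => ?_) ?_ hlim
  · have := (zeroProb_pos F (r i)).le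
    positivity
  · filter_upwards [hC.bound] with i hi
    have hp := (zeroProb_pos F (r i)).le
    gcongr
    refine div_le_of_le_mul₀ (Nat.cast_nonneg _) hC0 ?_
    simpa using hi

theorem tendsto_expect_of_growthCondition {F : Type*} [Field F] [Fintype F] [DecidableEq F]
    {ι : Type*} {l : Filter ι} {A : Finset F}
    (hA : A.Nonempty) (hA' : A ≠ Finset.univ) {m n r : ι → ℕ}
    (hm : ∀ i, 0 < m i) (hn : ∀ i, 0 < n i) (hr : ∀ i, 0 < r i) (hmt : Tendsto m l atTop)
    (h : GrowthCondition (Fintype.card F) l m n r) (k : ℕ) :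
    Tendsto (fun i => 𝔼 z : (Fin (m i) → Fin (r i) → F) × (Fin (n i) → Fin (r i) → F),
      (centredCount A z.1 z.2 / √(sigmaSqA A (m i) (n i) (r i))) ^ k) l (𝓝 (gaussMoment k)) := by
  rcases h with h | h | ⟨hΘ, h⟩
  · exact tendsto_expect_of_linear_dominant hA hA' hm hn hr h k
  · refine tendsto_expect_of_degenerate_dominant hA hA' hm hn hmt
      (tendsto_ratio_pow_mul_of_superpolynomial F hm h)
      (tendsto_ratio_pow_mul_of_superpolynomial F hn ?_) k
    simpa only [add_comm] using h
  · have hp : Tendsto (fun i => (m i : ℝ) * zeroProb F (r i)) l (𝓝 0) :=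
      h.inv_tendsto_atTop.congr fun i => by
        rw [Pi.inv_apply, inv_div, div_eq_mul_inv]; rfl
    have hp' : Tendsto (fun i => (n i : ℝ) * zeroProb F (r i)) l (𝓝 0) :=
      (hΘ.2.mul (isBigO_refl (fun i => zeroProb F (r i)) l)).trans_tendsto hp
    exact tendsto_expect_of_degenerate_dominant hA hA' hm hn hmt
      (tendsto_ratio_pow_mul_of_isBigO F hΘ.2 hp) (tendsto_ratio_pow_mul_of_isBigO F hΘ.1 hp') k

theorem integral_ctNormalized_pow {F : Type*} [Field F] [Fintype F] [DecidableEq F]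
    (A : Finset F) {Ω : Type*} [MeasurableSpace Ω] (P : Measure Ω) [IsProbabilityMeasure P]
    {m n r : ℕ} (X : Ω → Matrix (Fin m) (Fin r) F) (Y : Ω → Matrix (Fin r) (Fin n) F)
    (hX : IsUniformMatrix P X) (hY : IsUniformMatrix P Y) (hXY : IndepFun X Y P) (k : ℕ) :
    ∫ ω, ctNormalized A r (X ω * Y ω) ^ k ∂P
      = 𝔼 z : (Fin m → Fin r → F) × (Fin n → Fin r → F),
        (centredCount A z.1 z.2 / √(sigmaSqA A m n r)) ^ k := by
  rw [integral_comp_of_isUniformMatrix P X Y hX hY hXY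
    (fun x y => ctNormalized A r (x * y) ^ k), expect_prod_type]
  simp_rw [ctNormalized, ct_sub_muA]

theorem theorem2 {F : Type*} [Field F] [Fintype F] [DecidableEq F]
    (A : Finset F) (hA : A.Nonempty) (hA' : A ≠ Finset.univ)
    {ι : Type*} (l : Filter ι) (m n r : ι → ℕ)
    (hm : ∀ i, 0 < m i) (hn : ∀ i, 0 < n i) (hr : ∀ i, 0 < r i)
    {Ω : ι → Type*} [∀ i, MeasurableSpace (Ω i)]
    (P : ∀ i, Measure (Ω i)) [∀ i, IsProbabilityMeasure (P i)]
    (X : ∀ i, Ω i → Matrix (Fin (m i)) (Fin (r i)) F)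
    (Y : ∀ i, Ω i → Matrix (Fin (r i)) (Fin (n i)) F)
    (hX : ∀ i, IsUniformMatrix (P i) (X i))
    (hY : ∀ i, IsUniformMatrix (P i) (Y i))
    (hXY : ∀ i, IndepFun (X i) (Y i) (P i)) :
    (∀ i,
      ∫ ω, (ct A (X i ω * Y i ω) : ℝ) ∂(P i) = muA A (m i) (n i) (r i) ∧
      variance (fun ω => (ct A (X i ω * Y i ω) : ℝ)) (P i) = sigmaSqA A (m i) (n i) (r i) ∧
      0 < sigmaSqA A (m i) (n i) (r i) ∧
      ∫ ω, ctNormalized A (r i) (X i ω * Y i ω) ∂(P i) = 0 ∧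
      ∫ ω, ctNormalized A (r i) (X i ω * Y i ω) ^ 2 ∂(P i) = 1) ∧
    (Tendsto m l atTop → Tendsto n l atTop →
      GrowthCondition (Fintype.card F) l m n r →
      ∀ k : ℕ, 3 ≤ k →
        (Odd k → Tendsto (fun i => ∫ ω, ctNormalized A (r i) (X i ω * Y i ω) ^ k ∂(P i))
          l (𝓝 0)) ∧
        (Even k → Tendsto (fun i => ∫ ω, ctNormalized A (r i) (X i ω * Y i ω) ^ k ∂(P i))
          l (𝓝 ((k - 1).doubleFactorial : ℝ)))) := by
  refine ⟨fun i => ?_, fun hmt hnt hG k _ => ?_⟩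
  · have hT := integral_comp_of_isUniformMatrix (P i) (X i) (Y i) (hX i) (hY i) (hXY i)
    have hσ := sigmaSqA_pos hA hA' (hm i) (hn i) (hr i)
    have hmean : ∫ ω, (ct A (X i ω * Y i ω) : ℝ) ∂(P i) = muA A (m i) (n i) (r i) := by
      rw [hT fun x y => (ct A (x * y) : ℝ)]
      have h := expect_centredCount A (m i) (n i) (r i)
      simp_rw [← ct_sub_muA, Finset.expect_sub_distrib, Fintype.expect_const] at h
      linarith
    have hmeas : AEMeasurable (fun ω => (ct A (X i ω * Y i ω) : ℝ)) (P i) :=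
      aemeasurable_comp_of_isUniformMatrix (hX i) (hY i) fun x y => (ct A (x * y) : ℝ)
    refine ⟨hmean, ?_, hσ, ?_, ?_⟩
    · rw [variance_eq_integral hmeas, hmean,
        hT fun x y => ((ct A (x * y) : ℝ) - muA A (m i) (n i) (r i)) ^ 2]
      simp_rw [ct_sub_muA, expect_centredCount_sq]
    · have h := integral_ctNormalized_pow A (P i) (X i) (Y i) (hX i) (hY i) (hXY i) 1
      simp_rw [pow_one, ← Finset.expect_div, expect_prod_type, expect_centredCount, zero_div] at h
      exact h
    · rw [integral_ctNormalized_pow A (P i) (X i) (Y i) (hX i) (hY i) (hXY i) 2]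
      simp_rw [div_pow, ← Finset.expect_div]
      rw [expect_prod_type, expect_centredCount_sq, Real.sq_sqrt hσ.le, div_self hσ.ne']
  · have key := tendsto_expect_of_growthCondition hA hA' hm hn hr hmt hG k
    replace key := key.congr fun i =>
      (integral_ctNormalized_pow A (P i) (X i) (Y i) (hX i) (hY i) (hXY i) k).symm
    exact ⟨fun hk => by rwa [gaussMoment_odd hk] at key,
      fun hk => by rwa [gaussMoment_even hk] at key⟩
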